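/- Let $n\ge 0$ be an integer and let $\alpha_1,\dots,\alpha_n,\beta_1,\dots,\beta_n\in\mathbb{C}$ be such that $\alpha_k-\beta_l\notin\mathbb{Z}$ for all $1\le k,l\le n$. Let $L$ be a piecewise continuously differentiable path from $i\infty$ to $-i\infty$ that runs along the imaginary axis outside a bounded set, such that all points $-\alpha_k-m$ ($1\le k\le n$, $m\in\mathbb{Z}_{\ge0}$) lie to the left of $L$ and all points $1-\beta_k+m$ ($1\le k\le n$, $m\in\mathbb{Z}_{\ge 0}$) lie to the right of $L$; here "left" (respectively "right") means in the connected component of $\mathbb{C}\setminus L$ that contains all $s$ with negative (respectively positive) real part and sufficiently large modulus. For $z\in\mathbb{C}\setminus\mathbb{R}_{\ge0}$ put $z^s=e^{s(\log|z|+i\arg z)}$ with $\arg z\in(0,2\pi)$, and for $j=0,1,\dots,n-1$ let $$I_j(z)=\frac{(-1)^n}{(2\pi i)^n}\int_L\Big(\prod_{k=1}^n\Gamma(\alpha_k+s)\,\Gamma(1-\beta_k-s)\Big)e^{(2j-n)\pi i s}z^s\,ds .$$ Then these integrals converge absolutely for all $z\in\mathbb{C}\setminus\mathbb{R}_{\ge0}$,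 and the functions $I_0,\dots,I_{n-1}$ form a basis of the complex vector space of holomorphic solutions $f$ on $\mathbb{C}\setminus\mathbb{R}_{\ge0}$ of the generalized hypergeometric equation $$\big[z(\theta+\alpha_1)\cdots(\theta+\alpha_n)-(\theta+\beta_1-1)\cdots(\theta+\beta_n-1)\big]f(z)=0,\qquad \theta=z\frac{d}{dz}.$$ -/

import Mathlib

namespace MellinBarnes

/-- The cut plane `ℂ ∖ ℝ_{≥ 0}`. -/
def cutPlane : Set ℂ := {z : ℂ | z.re < 0 ∨ z.im ≠ 0}

/-- The branch of the logarithm on `ℂ ∖ ℝ_{≥ 0}` with imaginary part in `(0, 2π)`: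
`arg (-z)` lies in `(-π, π)` there, and `log (-z) + π i` is a logarithm of `z`. -/
noncomputable def cutLog (z : ℂ) : ℂ := Complex.log (-z) + Real.pi * Complex.I

/-- The integrand
`∏ₖ Γ(αₖ + s) Γ(1 - βₖ - s) · e^{(2j - n) π i s} · z ^ s`,
where `z ^ s` is taken with the argument of `z` in `(0, 2π)`. -/
noncomputable def integrand {n : ℕ} (α β : Fin n → ℂ) (j : Fin n) (z s : ℂ) : ℂ :=
  (∏ k, Complex.Gamma (α k + s) * Complex.Gamma (1 - β k - s)) *
    Complex.exp ((2 * (j : ℕ) - n) * Real.pi * Complex.I * s) * Complex.exp (s * cutLog z)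

/-- The points to the left of the path `γ`: those in the connected component of the complement
of the path that contains all `s` of negative real part and large modulus. -/
def leftSide (γ : ℝ → ℂ) : Set ℂ :=
  {p | ∃ R : ℝ, ∀ s : ℂ, s.re < 0 → R < ‖s‖ → s ∈ connectedComponentIn (Set.range γ)ᶜ p}

/-- The points to the right of the path `γ`: those in the connected component of the complement
of the path that contains all `s` of positive real part and large modulus. -/
def rightSide (γ : ℝ → ℂ) : Set ℂ :=
  {p | ∃ R : ℝ, ∀ s : ℂ, 0 < s.re → R < ‖s‖ → s ∈ connectedComponentIn (Set.range γ)ᶜ p}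

/-- A piecewise continuously differentiable path from `i∞` to `-i∞` which runs along the imaginary
axis near both ends and has all points `-αₖ - m` on its left and all points `1 - βₖ + m` on its
right, `m = 0, 1, 2, …`. -/
structure IsContour {n : ℕ} (α β : Fin n → ℂ) (γ : ℝ → ℂ) : Prop where
  continuous : Continuous γ
  piecewise_C1 : ∃ S : Finset ℝ, ∃ C : ℝ, ∀ t ∉ S, ContDiffAt ℝ 1 γ t ∧ ‖deriv γ t‖ ≤ C
  ends : ∃ T : ℝ, ∀ t : ℝ, T ≤ |t| → γ t = -(t * Complex.I)
  left : ∀ (k : Fin n) (m : ℕ), -α k - m ∈ leftSide γ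
  right : ∀ (k : Fin n) (m : ℕ), 1 - β k + m ∈ rightSide γ

/-- The Mellin–Barnes integral `I_j(z)` along the path `γ`. -/
noncomputable def barnesIntegral {n : ℕ} (α β : Fin n → ℂ) (γ : ℝ → ℂ) (j : Fin n) (z : ℂ) : ℂ :=
  (-1) ^ n / (2 * Real.pi * Complex.I) ^ n * ∫ t : ℝ, integrand α β j z (γ t) * deriv γ t

/-- The first order operator `θ + c`, where `θ = z d/dz`. -/
noncomputable def thetaAdd (c : ℂ) (f : ℂ → ℂ) : ℂ → ℂ := fun z => z * deriv f z + c * f z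

/-- The composition `(θ + c₁) ⋯ (θ + cₙ)`. -/
noncomputable def thetaProd {n : ℕ} (c : Fin n → ℂ) (f : ℂ → ℂ) : ℂ → ℂ :=
  (List.ofFn c).foldr thetaAdd f

/-- The generalized hypergeometric operator
`z (θ + α₁) ⋯ (θ + αₙ) - (θ + β₁ - 1) ⋯ (θ + βₙ - 1)`. -/
noncomputable def hypergeometricOp {n : ℕ} (α β : Fin n → ℂ) (f : ℂ → ℂ) : ℂ → ℂ :=
  fun z => z * thetaProd α f z - thetaProd (fun k => β k - 1) f z

theorem isOpen_cutPlane : IsOpen cutPlane :=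
  (isOpen_lt Complex.continuous_re continuous_const).union
    (isOpen_ne_fun Complex.continuous_im continuous_const)

theorem differentiableOn_foldr_thetaAdd (l : List ℂ) {f : ℂ → ℂ}
    (hf : DifferentiableOn ℂ f cutPlane) :
    DifferentiableOn ℂ (l.foldr thetaAdd f) cutPlane := by
  induction l with
  | nil => exact hf
  | cons c l ih =>
    exact (differentiableOn_id.mul (ih.deriv isOpen_cutPlane)).add (ih.const_mul c)

theorem foldr_thetaAdd_combination (l : List ℂ) (a : ℂ) {f g : ℂ → ℂ}
    (hf : DifferentiableOn ℂ f cutPlane) (hg : DifferentiableOn ℂ g cutPlane) :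
    ∀ z ∈ cutPlane, l.foldr thetaAdd (fun w => a * f w + g w) z =
      a * l.foldr thetaAdd f z + l.foldr thetaAdd g z := by
  induction l with
  | nil => intro z _; rfl
  | cons c l ih =>
    intro z hz
    have hU := isOpen_cutPlane.mem_nhds hz
    have hF := (differentiableOn_foldr_thetaAdd l hf).differentiableAt hU
    have hG := (differentiableOn_foldr_thetaAdd l hg).differentiableAt hU
    have hd : deriv (l.foldr thetaAdd fun w => a * f w + g w) z =
        a * deriv (l.foldr thetaAdd f) z + deriv (l.foldr thetaAdd g) z := by
      rw [Filter.EventuallyEq.deriv_eq (Filter.eventually_of_mem hU ih)]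
      exact ((hF.hasDerivAt.const_mul a).add hG.hasDerivAt).deriv
    simp only [List.foldr_cons, thetaAdd]
    rw [hd, ih z hz]
    ring

theorem foldr_thetaAdd_zero (l : List ℂ) : l.foldr thetaAdd (fun _ => 0) = fun _ => 0 := by
  induction l with
  | nil => rfl
  | cons c l ih => rw [List.foldr_cons, ih]; funext z; simp [thetaAdd]

theorem hypergeometricOp_combination {n : ℕ} (α β : Fin n → ℂ) (a : ℂ) {f g : ℂ → ℂ}
    (hf : DifferentiableOn ℂ f cutPlane) (hg : DifferentiableOn ℂ g cutPlane) {z : ℂ}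
    (hz : z ∈ cutPlane) :
    hypergeometricOp α β (fun w => a * f w + g w) z =
      a * hypergeometricOp α β f z + hypergeometricOp α β g z := by
  simp only [hypergeometricOp, thetaProd]
  rw [foldr_thetaAdd_combination _ a hf hg z hz, foldr_thetaAdd_combination _ a hf hg z hz]
  ring

theorem hypergeometricOp_zero {n : ℕ} (α β : Fin n → ℂ) (z : ℂ) :
    hypergeometricOp α β (fun _ => 0) z = 0 := by
  simp [hypergeometricOp, thetaProd, foldr_thetaAdd_zero]

/-- The complex vector space of holomorphic functions on `ℂ ∖ ℝ_{≥ 0}` that solve the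
generalized hypergeometric equation. (A function on the cut plane is differentiated through an
arbitrary extension `g` to `ℂ`; as the cut plane is open, the choice does not matter.) -/
noncomputable def solutionSpace {n : ℕ} (α β : Fin n → ℂ) : Submodule ℂ (cutPlane → ℂ) where
  carrier := {f | ∃ g : ℂ → ℂ, (∀ z : cutPlane, g z = f z) ∧ DifferentiableOn ℂ g cutPlane ∧
    ∀ z ∈ cutPlane, hypergeometricOp α β g z = 0}
  zero_mem' :=
    ⟨fun _ => 0, fun _ => rfl, differentiableOn_const 0, fun z _ => hypergeometricOp_zero α β z⟩
  add_mem' := by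
    rintro f₁ f₂ ⟨g₁, h₁, d₁, e₁⟩ ⟨g₂, h₂, d₂, e₂⟩
    refine ⟨fun w => 1 * g₁ w + g₂ w, fun z => ?_, (d₁.const_mul 1).add d₂, fun z hz => ?_⟩
    · simp [h₁ z, h₂ z]
    · rw [hypergeometricOp_combination α β 1 d₁ d₂ hz, e₁ z hz, e₂ z hz]; simp
  smul_mem' := by
    rintro a f ⟨g, h, d, e⟩
    refine ⟨fun w => a * g w + 0, fun z => ?_,
      (d.const_mul a).add (differentiableOn_const 0), fun z hz => ?_⟩
    · simp [h z]
    · rw [hypergeometricOp_combination α β a d (differentiableOn_const 0) hz, e z hz,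
        hypergeometricOp_zero]
      simp

end MellinBarnes

/-! Put `ζ = log z`, with `0 < Im ζ < 2π`, `a = α` and `b = 1 - β`. Each `Γ(a + s) Γ(b - s)` decays
like `exp (-π |Im s|)` up to a power of `|s|`. For `0 ≤ j < n` and `ζ` in the strip, the factors
`e^{(2j-n)πis} e^{sζ}` still leave exponential decay (`exists_norm_barnesFun_le`). So the integrals
converge locally uniformly in `ζ`, and `θ = d/dζ` acts under the integral as multiplication by `s`.

Let `G` be the integrand with every `b` raised by 1. By the functional equation of `Γ`, the two
halves of the hypergeometric operator give, up to the common sign `(-1)^n`, the integrals of `G(s +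
1)` and of `G(s)` over the path, so these must agree (`integral_barnesFun_add_one`). If a vertical
line separates the two families of poles, the path may be replaced by it, and the claim is a
translation of the line. In general there is no such line, but multiplying by a polynomial that
cancels enough poles of one family creates one. The polynomials that serve the two families are
coprime because no `α - β` is an integer, and Bézout's identity gives the general case.

The replacement of an arbitrary path by a line (`deviation_eq_zero`) needs no Jordan curve theorem.
Subtracting principal parts reduces it to `1/(s - p)`, whose integral, as a function of `p`, is a
branch of a logarithm on each component of the complement. The branch is found by letting `p` tend
to infinity.

For independence, a relation `∑ c_j I_j = 0` survives the insertion of any polynomial in `s`, so it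
can be moved to a vertical line, where Fourier inversion makes the combined integrand vanish. Hence
the polynomial `∑ c_j X^j` vanishes at all the values `e^{2πis}` on that line, which are infinitely
many (`eq_zero_of_sum_barnesInt_eq_zero`). Conversely the solution space has dimension at most `n`,
since `-1` is a regular point of the equation and a solution is determined there by `n` initial
values (`initialValues_injective`). -/

namespace MellinBarnes

open MeasureTheory Filter Topology Set

/-! ### Calculus along the path -/

/-- A continuous, piecewise continuously differentiable path from `i∞` to `-i∞` that runs along the
imaginary axis near both ends. -/
structure IsImaginaryPath (γ : ℝ → ℂ) : Prop where
  continuous : Continuous γ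
  piecewise_C1 : ∃ S : Finset ℝ, ∃ C : ℝ, ∀ t ∉ S, ContDiffAt ℝ 1 γ t ∧ ‖deriv γ t‖ ≤ C
  ends : ∃ T : ℝ, ∀ t : ℝ, T ≤ |t| → γ t = -(t * Complex.I)

theorem IsContour.isImaginaryPath {n : ℕ} {α β : Fin n → ℂ} {γ : ℝ → ℂ} (h : IsContour α β γ) :
    IsImaginaryPath γ :=
  ⟨h.continuous, h.piecewise_C1, h.ends⟩

theorem notMem_range_of_mem_leftSide {γ : ℝ → ℂ} {p : ℂ} (hp : p ∈ leftSide γ) :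
    p ∉ range γ := by
  obtain ⟨R, hR⟩ := hp
  have h := hR (-(|R| + 1 : ℝ) : ℂ) (by simp only [Complex.neg_re, Complex.ofReal_re]; linarith [abs_nonneg R]) (by
    rw [norm_neg, Complex.norm_real, Real.norm_eq_abs, abs_of_pos (by positivity)]
    linarith [le_abs_self R])
  exact connectedComponentIn_nonempty_iff.1 ⟨_, h⟩

theorem notMem_range_of_mem_rightSide {γ : ℝ → ℂ} {p : ℂ} (hp : p ∈ rightSide γ) :
    p ∉ range γ := by
  obtain ⟨R, hR⟩ := hp
  have h := hR ((|R| + 1 : ℝ) : ℂ) (by simp; positivity) (by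
    rw [Complex.norm_real, Real.norm_eq_abs, abs_of_pos (by positivity)]
    linarith [le_abs_self R])
  exact connectedComponentIn_nonempty_iff.1 ⟨_, h⟩

namespace IsImaginaryPath

variable {γ : ℝ → ℂ}

theorem exists_ae_norm_deriv_le (h : IsImaginaryPath γ) :
    ∃ C : ℝ, 0 ≤ C ∧ ∀ᵐ t : ℝ, ‖deriv γ t‖ ≤ C := by
  obtain ⟨S, C, hS⟩ := h.piecewise_C1
  refine ⟨|C|, abs_nonneg C, ?_⟩
  have : ∀ᵐ t : ℝ, t ∉ (S : Set ℝ) := S.countable_toSet.ae_notMem volume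
  filter_upwards [this] with t ht
  exact (hS t (by simpa using ht)).2.trans (le_abs_self C)

theorem intervalIntegrable_mul_deriv (h : IsImaginaryPath γ) {g : ℝ → ℂ} {a b : ℝ}
    (hg : ContinuousOn g (uIcc a b)) :
    IntervalIntegrable (fun t => g t * deriv γ t) volume a b := by
  obtain ⟨C, -, hC⟩ := h.exists_ae_norm_deriv_le
  refine IntervalIntegrable.continuousOn_mul ?_ hg
  refine (intervalIntegrable_const (c := C)).mono_fun (measurable_deriv γ).aestronglyMeasurable ?_
  filter_upwards [ae_restrict_of_ae hC] with t ht
  exact ht.trans (le_abs_self C)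

/-- The fundamental theorem of calculus along a piecewise continuously differentiable path. -/
theorem integral_eq_sub (h : IsImaginaryPath γ) {F f : ℂ → ℂ} {a b : ℝ}
    (hf : ContinuousOn f (γ '' uIcc a b)) (hF : ∀ s ∈ γ '' uIcc a b, HasDerivAt F (f s) s) :
    ∫ t in a..b, f (γ t) * deriv γ t = F (γ b) - F (γ a) := by
  obtain ⟨S, C, hS⟩ := h.piecewise_C1
  refine integral_eq_of_hasDerivAt_off_countable (fun t => F (γ t)) _ S.countable_toSet ?_ ?_
    (h.intervalIntegrable_mul_deriv (hf.comp h.continuous.continuousOn (mapsTo_image γ _)))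
  · exact fun t ht => ((hF _ (mem_image_of_mem γ ht)).continuousAt.comp h.continuous.continuousAt)
      |>.continuousWithinAt
  · intro t ht
    have hd : HasDerivAt γ (deriv γ t) t :=
      ((hS t (by simpa using ht.2)).1.differentiableAt one_ne_zero).hasDerivAt
    exact (hF _ (mem_image_of_mem γ (Ioo_subset_Icc_self ht.1))).comp t hd

theorem exists_pos_ends (h : IsImaginaryPath γ) :
    ∃ T : ℝ, 0 < T ∧ ∀ t : ℝ, T ≤ |t| → γ t = -(t * Complex.I) := by
  obtain ⟨T, hT⟩ := h.ends
  exact ⟨max T 1, by positivity, fun t ht => hT t ((le_max_left _ _).trans ht)⟩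

/-- Since `‖γ t‖ = |t|` for large `|t|`, the path is a proper map. Closedness makes the components
of the complement open. -/
theorem isClosed_range (h : IsImaginaryPath γ) : IsClosed (range γ) := by
  obtain ⟨T, hT0, hT⟩ := h.exists_pos_ends
  have hc : Tendsto γ (cocompact ℝ) (cocompact ℂ) := by
    rw [← Metric.cobounded_eq_cocompact, ← Metric.cobounded_eq_cocompact,
      ← tendsto_norm_atTop_iff_cobounded]
    refine tendsto_norm_cobounded_atTop.congr' ?_
    filter_upwards [tendsto_norm_cobounded_atTop.eventually_ge_atTop T] with t ht
    rw [hT t ht]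
    simp
  exact (isProperMap_iff_tendsto_cocompact.2 ⟨h.continuous, hc⟩).isClosedMap.isClosed_range

/-- The integral of `1 / (s - p)` along the part `[-T, T]` of the path. -/
theorem hasDerivAt_integral_inv_sub (h : IsImaginaryPath γ) (T : ℝ) {p : ℂ} (hp : p ∉ range γ) :
    HasDerivAt (fun q => ∫ t in -T..T, (γ t - q)⁻¹ * deriv γ t)
      ((γ (-T) - p)⁻¹ - (γ T - p)⁻¹) p := by
  obtain ⟨C, hC0, hC⟩ := h.exists_ae_norm_deriv_le
  obtain ⟨ε, hε, hball⟩ := Metric.isOpen_iff.1 h.isClosed_range.isOpen_compl p hp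
  have hfar : ∀ q ∈ Metric.ball p (ε / 2), ∀ t, ε / 2 ≤ ‖γ t - q‖ := by
    intro q hq t
    by_contra! hlt
    refine hball (a := γ t) ?_ ⟨t, rfl⟩
    rw [Metric.mem_ball, dist_eq_norm] at hq ⊢
    calc ‖γ t - p‖ = ‖(γ t - q) + (q - p)‖ := by ring_nf
      _ ≤ _ := norm_add_le _ _
      _ < ε := by linarith
  have hne : ∀ q ∈ Metric.ball p (ε / 2), ∀ t, γ t - q ≠ 0 := fun q hq t h0 => by
    have := hfar q hq t
    rw [h0, norm_zero] at this
    linarith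
  have hcont : ∀ q ∈ Metric.ball p (ε / 2), Continuous fun t => (γ t - q)⁻¹ := fun q hq =>
    (h.continuous.sub continuous_const).inv₀ (hne q hq)
  have hp' : p ∈ Metric.ball p (ε / 2) := Metric.mem_ball_self (by positivity)
  have hmem : Metric.ball p (ε / 2) ∈ 𝓝 p := Metric.ball_mem_nhds p (by positivity)
  have hm : Measurable (deriv γ) := measurable_deriv γ
  have hF_meas : ∀ᶠ q in 𝓝 p, AEStronglyMeasurable (fun t => (γ t - q)⁻¹ * deriv γ t)
      (volume.restrict (uIoc (-T) T)) := eventually_of_mem hmem fun q hq =>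
    (hcont q hq).aestronglyMeasurable.mul hm.aestronglyMeasurable
  have hF'_meas : AEStronglyMeasurable (fun t => ((γ t - p) ^ 2)⁻¹ * deriv γ t)
      (volume.restrict (uIoc (-T) T)) :=
    (((h.continuous.sub continuous_const).pow 2).inv₀
      fun t => pow_ne_zero 2 (hne p hp' t)).aestronglyMeasurable.mul hm.aestronglyMeasurable
  have hbound : ∀ᵐ t, t ∈ uIoc (-T) T → ∀ q ∈ Metric.ball p (ε / 2),
      ‖((γ t - q) ^ 2)⁻¹ * deriv γ t‖ ≤ ((ε / 2) ^ 2)⁻¹ * C := by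
    filter_upwards [hC] with t ht _ q hq
    rw [norm_mul, norm_inv, norm_pow]
    gcongr
    exact hfar q hq t
  have hdiff : ∀ t, ∀ q ∈ Metric.ball p (ε / 2), HasDerivAt (fun q => (γ t - q)⁻¹ * deriv γ t)
      (((γ t - q) ^ 2)⁻¹ * deriv γ t) q := by
    intro t q hq
    have h1 : HasDerivAt (fun q => γ t - q) (-1) q :=
      (hasDerivAt_id q).const_sub (γ t)
    have h2 := (h1.fun_inv (hne q hq t)).mul_const (deriv γ t)
    simpa using h2
  have key := intervalIntegral.hasDerivAt_integral_of_dominated_loc_of_deriv_le hmem hF_meas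
    (h.intervalIntegrable_mul_deriv (hcont p hp').continuousOn) hF'_meas hbound intervalIntegrable_const
    (Eventually.of_forall fun t _ => hdiff t)
  have hne' : ∀ s ∈ γ '' uIcc (-T) T, s - p ≠ 0 := by
    rintro _ ⟨t, -, rfl⟩
    exact hne p hp' t
  refine key.2.congr_deriv ?_
  -- The differentiated integrand `(s - p)⁻²` has a primitive, so only the end points of the path
  -- enter.
  rw [h.integral_eq_sub (F := fun s => -(s - p)⁻¹) (f := fun s => ((s - p) ^ 2)⁻¹)]
  · ring
  · exact ((continuousOn_id.sub continuousOn_const).pow 2).inv₀ fun s hs => pow_ne_zero 2 (hne' s hs)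
  · intro s hs
    have h1 : HasDerivAt (fun s => s - p) 1 s := (hasDerivAt_id s).sub_const p
    have h2 := (h1.fun_inv (hne' s hs)).fun_neg
    simpa [neg_div] using h2

/-- This limit fixes the constant of integration, hence the branch of the logarithm, on the two
unbounded sides. -/
theorem tendsto_integral_inv_sub (h : IsImaginaryPath γ) (T : ℝ) :
    Tendsto (fun q => ∫ t in -T..T, (γ t - q)⁻¹ * deriv γ t) (Bornology.cobounded ℂ) (𝓝 0) := by
  obtain ⟨C, hC0, hC⟩ := h.exists_ae_norm_deriv_le
  obtain ⟨B, hB⟩ := (isCompact_uIcc (a := -T) (b := T)).exists_bound_of_continuousOn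
    h.continuous.continuousOn
  have hlim : Tendsto (fun q : ℂ => (‖q‖ - B)⁻¹ * C * |T - -T|) (Bornology.cobounded ℂ) (𝓝 0) := by
    have := (tendsto_inv_atTop_zero.comp
      (tendsto_atTop_add_const_right _ (-B) (tendsto_norm_cobounded_atTop (E := ℂ))))
    simpa [sub_eq_add_neg] using (this.mul_const C).mul_const |T - -T|
  refine squeeze_zero_norm' ?_ hlim
  filter_upwards [(tendsto_norm_cobounded_atTop (E := ℂ)).eventually_gt_atTop B] with q hq
  refine intervalIntegral.norm_integral_le_of_norm_le_const_ae ?_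
  filter_upwards [hC] with t ht hmem
  rw [norm_mul, norm_inv]
  have h1 := hB t (uIoc_subset_uIcc hmem)
  have h2 : ‖q‖ - B ≤ ‖γ t - q‖ := by
    have := norm_sub_norm_le q (γ t)
    rw [norm_sub_rev] at this
    linarith
  gcongr

end IsImaginaryPath

/-! ### The logarithm on the cut plane -/

theorem neg_mem_slitPlane {z : ℂ} (hz : z ∈ cutPlane) : -z ∈ Complex.slitPlane := by
  rcases hz with h | h
  · exact Or.inl (by simpa using h)
  · exact Or.inr (by simpa using h)

theorem ne_zero_of_mem_cutPlane {z : ℂ} (hz : z ∈ cutPlane) : z ≠ 0 :=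
  neg_ne_zero.1 (Complex.slitPlane_ne_zero (neg_mem_slitPlane hz))

theorem exp_cutLog {z : ℂ} (hz : z ≠ 0) : Complex.exp (cutLog z) = z := by
  rw [cutLog, Complex.exp_add, Complex.exp_log (neg_ne_zero.2 hz), Complex.exp_pi_mul_I]
  ring

theorem cutLog_im {z : ℂ} (hz : z ∈ cutPlane) :
    0 < (cutLog z).im ∧ (cutLog z).im < 2 * Real.pi := by
  have h1 := Complex.neg_pi_lt_log_im (-z)
  have h2 : (Complex.log (-z)).im ≠ Real.pi := by
    rw [Complex.log_im]
    exact Complex.mem_slitPlane_iff_arg.1 (neg_mem_slitPlane hz) |>.1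
  have h3 := lt_of_le_of_ne (Complex.log_im_le_pi (-z)) h2
  have h4 : (cutLog z).im = (Complex.log (-z)).im + Real.pi := by simp [cutLog]
  rw [h4]
  constructor <;> linarith

theorem cutLog_exp {w : ℂ} (h0 : 0 < w.im) (h1 : w.im < 2 * Real.pi) :
    cutLog (Complex.exp w) = w := by
  have h : -Complex.exp w = Complex.exp (w - Real.pi * Complex.I) := by
    rw [Complex.exp_sub, Complex.exp_pi_mul_I]
    ring
  rw [cutLog, h, Complex.log_exp (by simp; linarith) (by simp; linarith)]
  ring

theorem exp_mem_cutPlane {w : ℂ} (h0 : 0 < w.im) (h1 : w.im < 2 * Real.pi) :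
    Complex.exp w ∈ cutPlane := by
  by_contra h
  simp only [cutPlane, mem_ofPred_eq, not_or, not_lt, not_not] at h
  have h2 : Complex.exp w = (Complex.exp w).re := Complex.ext (by simp) (by simp [h.2])
  have h3 : 0 ≤ (Complex.exp w).re := h.1
  have h4 := cutLog_exp h0 h1
  rw [h2, cutLog, ← Complex.ofReal_neg] at h4
  have h5 := congrArg Complex.im h4
  rcases h3.lt_or_eq with h6 | h6
  · rw [Complex.add_im, Complex.log_im, Complex.arg_ofReal_of_neg (by linarith)] at h5
    simp at h5
    linarith
  · exact Complex.exp_ne_zero w (by rw [h2, ← h6]; simp)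

theorem hasDerivAt_cutLog {z : ℂ} (hz : z ∈ cutPlane) : HasDerivAt cutLog z⁻¹ z := by
  have h := ((hasDerivAt_neg z).clog (neg_mem_slitPlane hz)).add_const (Real.pi * Complex.I)
  have e : -1 / -z = z⁻¹ := by rw [neg_div_neg_eq, one_div]
  rwa [e] at h
-- The integral of `1 / (s - p)` as a function of `p`
namespace IsImaginaryPath

variable {γ : ℝ → ℂ}

/-- If the quotient equals a real `r ≥ 0`, comparing real parts gives `r = 1`, which is absurd, or
`Re p = 0`. In the latter case the imaginary parts force `|Im p| ≥ T`, so `p` lies on an end of the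
path. -/
theorem div_mem_cutPlane {T : ℝ} (hT0 : 0 < T)
    (hT : ∀ t : ℝ, T ≤ |t| → γ t = -(t * Complex.I)) {p : ℂ} (hp : p ∉ range γ) :
    p - T * Complex.I ≠ 0 ∧ (p + T * Complex.I) / (p - T * Complex.I) ∈ cutPlane := by
  have hne : p - T * Complex.I ≠ 0 := fun h => hp ⟨-T, by
    rw [hT _ (by rw [abs_neg]; exact le_abs_self T), sub_eq_zero.1 h]
    push_cast
    ring⟩
  refine ⟨hne, ?_⟩
  by_contra h
  simp only [cutPlane, mem_ofPred_eq, not_or, not_lt, not_not] at h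
  set r := ((p + T * Complex.I) / (p - T * Complex.I)).re with hr
  have h2 : (p + T * Complex.I) / (p - T * Complex.I) = r := Complex.ext (by simp [hr]) (by simp [h.2])
  have hr0 : 0 ≤ r := h.1
  rw [div_eq_iff hne] at h2
  have hre := congrArg Complex.re h2
  have him := congrArg Complex.im h2
  simp at hre him
  by_cases hx : p.re = 0
  · refine hp ⟨-p.im, ?_⟩
    rw [hT]
    · exact Complex.ext (by simp [hx]) (by simp)
    · rw [abs_neg]
      by_contra! hlt
      rw [abs_lt] at hlt
      nlinarith [mul_nonneg hr0 (sub_nonneg.2 hlt.2.le)]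
  · have : r = 1 := by
      have : p.re * (r - 1) = 0 := by linarith
      rcases mul_eq_zero.1 this with h | h
      · exact absurd h hx
      · linarith
    rw [this] at him
    linarith

/-- On each component of the complement of the path, the integral of `1 / (s - p)` is a branch of
the logarithm of `(p + T i) / (p - T i)`. -/
theorem integral_inv_sub_sub_cutLog_eq (h : IsImaginaryPath γ) {T : ℝ} (hT0 : 0 < T)
    (hT : ∀ t : ℝ, T ≤ |t| → γ t = -(t * Complex.I)) {p q : ℂ}
    (hq : q ∈ connectedComponentIn (range γ)ᶜ p) :
    (∫ t in -T..T, (γ t - q)⁻¹ * deriv γ t) - cutLog ((q + T * Complex.I) / (q - T * Complex.I)) =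
    (∫ t in -T..T, (γ t - p)⁻¹ * deriv γ t) - cutLog ((p + T * Complex.I) / (p - T * Complex.I)) := by
  have hp : p ∉ range γ := connectedComponentIn_nonempty_iff.1 ⟨q, hq⟩
  have hsub : connectedComponentIn (range γ)ᶜ p ⊆ (range γ)ᶜ := connectedComponentIn_subset _ _
  have hγ1 : γ (-T) = T * Complex.I := by
    rw [hT _ (by rw [abs_neg]; exact le_abs_self T)]; push_cast; ring
  have hγ2 : γ T = -(T * Complex.I) := hT _ (le_abs_self T)
  -- Both terms have derivative `1/(s + Ti) - 1/(s - Ti)`.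
  have hd : ∀ s ∈ connectedComponentIn (range γ)ᶜ p,
      HasDerivAt (fun q => (∫ t in -T..T, (γ t - q)⁻¹ * deriv γ t) -
        cutLog ((q + T * Complex.I) / (q - T * Complex.I))) 0 s := by
    intro s hs
    obtain ⟨hne, hmem⟩ := div_mem_cutPlane hT0 hT (hsub hs)
    have hne' : s + T * Complex.I ≠ 0 := fun h0 => by
      refine hsub hs ⟨T, ?_⟩
      rw [hγ2]
      linear_combination -h0
    have h0 : HasDerivAt (fun q : ℂ => (q + T * Complex.I) / (q - T * Complex.I))
        ((1 * (s - T * Complex.I) - (s + T * Complex.I) * 1) / (s - T * Complex.I) ^ 2) s :=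
      ((hasDerivAt_id s).add_const (T * Complex.I)).fun_div
        ((hasDerivAt_id s).sub_const (T * Complex.I)) hne
    have h1 := HasDerivAt.comp (h₂ := cutLog) s (hasDerivAt_cutLog hmem) h0
    refine ((h.hasDerivAt_integral_inv_sub T (hsub hs)).fun_sub h1).congr_deriv ?_
    rw [hγ1, hγ2]
    have e1 : (T * Complex.I - s) = -(s - T * Complex.I) := by ring
    have e2 : (-(T * Complex.I) - s) = -(s + T * Complex.I) := by ring
    rw [e1, e2]
    field_simp
    ring
  refine IsOpen.is_const_of_deriv_eq_zero (h.isClosed_range.isOpen_compl.connectedComponentIn)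
    isPreconnected_connectedComponentIn
    (fun s hs => (hd s hs).differentiableAt.differentiableWithinAt) (fun s hs => (hd s hs).deriv)
    hq (mem_connectedComponentIn hp)

/-- For `T > 0` the imaginary part has the sign of `x`: as `x → ±∞` the quotient tends to the point
1 of the cut, from above for `x > 0` and from below for `x < 0`. -/
theorem div_ofReal_eq (T : ℝ) {x : ℝ} (hx : x ≠ 0) :
    ((x : ℂ) + T * Complex.I) / (x - T * Complex.I) =
      ((x ^ 2 - T ^ 2) / (x ^ 2 + T ^ 2) : ℝ) + (2 * x * T / (x ^ 2 + T ^ 2) : ℝ) * Complex.I := by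
  have h1 : (x : ℂ) - T * Complex.I ≠ 0 := fun h => hx (by simpa using congrArg Complex.re h)
  have h2 : (x : ℂ) ^ 2 + T ^ 2 ≠ 0 := by
    have : x ^ 2 + T ^ 2 ≠ 0 := by positivity
    exact_mod_cast this
  rw [div_eq_iff h1]
  push_cast
  field_simp
  ring_nf
  simp only [Complex.I_sq]
  ring

theorem tendsto_div_ofReal (T : ℝ) {l : Filter ℝ}
    (hl : Tendsto (fun x : ℝ => (x : ℂ)) l (Bornology.cobounded ℂ)) :
    Tendsto (fun x : ℝ => -(((x : ℂ) + T * Complex.I) / (x - T * Complex.I))) l (𝓝 (-1)) := by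
  have h1 : Tendsto (fun x : ℝ => ‖(x : ℂ) - T * Complex.I‖) l atTop := by
    refine tendsto_atTop_mono (fun x => norm_sub_norm_le _ _) ?_
    exact tendsto_atTop_add_const_right _ _ (tendsto_norm_atTop_iff_cobounded.2 hl)
  have h2 := tendsto_inv₀_cobounded.comp (tendsto_norm_atTop_iff_cobounded.1 h1)
  have h3 := (tendsto_const_nhds (x := (-1 : ℂ))).sub (h2.const_mul (2 * T * Complex.I))
  rw [mul_zero, sub_zero] at h3
  refine h3.congr' ?_
  filter_upwards [h1.eventually_gt_atTop 0] with x hx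
  have := norm_pos_iff.1 hx
  simp only [Function.comp]
  field_simp
  ring

/-- Let the point move to `+∞` along the real axis within its component. The integral tends to 0 and
the quotient reaches 1 from above, where `cutLog` tends to 0. -/
theorem integral_inv_sub_of_mem_rightSide (h : IsImaginaryPath γ) {T : ℝ} (hT0 : 0 < T)
    (hT : ∀ t : ℝ, T ≤ |t| → γ t = -(t * Complex.I)) {p : ℂ} (hp : p ∈ rightSide γ) :
    ∫ t in -T..T, (γ t - p)⁻¹ * deriv γ t =
      cutLog ((p + T * Complex.I) / (p - T * Complex.I)) := by
  obtain ⟨R, hR⟩ := hp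
  have hcob : Tendsto (fun x : ℝ => (x : ℂ)) atTop (Bornology.cobounded ℂ) :=
    (RCLike.tendsto_ofReal_atTop_cobounded ℂ)
  have h1 := (h.tendsto_integral_inv_sub T).comp hcob
  have h2 : Tendsto (fun x : ℝ => cutLog ((x + T * Complex.I) / (x - T * Complex.I))) atTop (𝓝 0) := by
    have h3 := (Complex.tendsto_log_nhdsWithin_im_neg_of_re_neg_of_im_zero (z := -1)
      (by simp) (by simp)).comp (tendsto_nhdsWithin_iff.2
        ⟨tendsto_div_ofReal T hcob, by
          filter_upwards [eventually_gt_atTop 0] with x hx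
          rw [div_ofReal_eq T hx.ne']
          have : 0 < 2 * x * T / (x ^ 2 + T ^ 2) := by positivity
          simpa only [mem_ofPred_eq, Complex.neg_im, Complex.add_im, Complex.ofReal_im,
            Complex.im_ofReal_mul, Complex.I_im, mul_one, zero_add, neg_lt_zero, neg_nonneg]
            using this⟩)
    have h4 := h3.add_const (Real.pi * Complex.I)
    simpa [cutLog, Function.comp_def] using h4
  have h3 := h1.sub h2
  have h4 : Tendsto (fun x : ℝ => (∫ t in -T..T, (γ t - p)⁻¹ * deriv γ t) -
      cutLog ((p + T * Complex.I) / (p - T * Complex.I))) atTop (𝓝 (0 - 0)) := by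
    refine h3.congr' ?_
    filter_upwards [eventually_gt_atTop 0, eventually_gt_atTop R] with x hx0 hxR
    refine h.integral_inv_sub_sub_cutLog_eq hT0 hT (hR x (by simpa using hx0) ?_)
    rwa [Complex.norm_real, Real.norm_of_nonneg hx0.le]
  simpa [sub_eq_zero] using tendsto_nhds_unique tendsto_const_nhds h4

/-- At `-∞` the quotient reaches 1 from below, where `cutLog` tends to `2πi`. This jump is the whole
difference between the two sides. -/
theorem integral_inv_sub_of_mem_leftSide (h : IsImaginaryPath γ) {T : ℝ} (hT0 : 0 < T)
    (hT : ∀ t : ℝ, T ≤ |t| → γ t = -(t * Complex.I)) {p : ℂ} (hp : p ∈ leftSide γ) :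
    ∫ t in -T..T, (γ t - p)⁻¹ * deriv γ t =
      cutLog ((p + T * Complex.I) / (p - T * Complex.I)) - 2 * Real.pi * Complex.I := by
  obtain ⟨R, hR⟩ := hp
  have hcob : Tendsto (fun x : ℝ => (x : ℂ)) atBot (Bornology.cobounded ℂ) :=
    (RCLike.tendsto_ofReal_atBot_cobounded ℂ)
  have h1 := (h.tendsto_integral_inv_sub T).comp hcob
  have h2 : Tendsto (fun x : ℝ => cutLog ((x + T * Complex.I) / (x - T * Complex.I))) atBot
      (𝓝 (2 * Real.pi * Complex.I)) := by
    have h3 := (Complex.tendsto_log_nhdsWithin_im_nonneg_of_re_neg_of_im_zero (z := -1)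
      (by simp) (by simp)).comp (tendsto_nhdsWithin_iff.2
        ⟨tendsto_div_ofReal T hcob, by
          filter_upwards [eventually_lt_atBot 0] with x hx
          rw [div_ofReal_eq T hx.ne]
          have : 2 * x * T / (x ^ 2 + T ^ 2) ≤ 0 :=
            div_nonpos_of_nonpos_of_nonneg (by nlinarith) (by positivity)
          simpa only [mem_ofPred_eq, Complex.neg_im, Complex.add_im, Complex.ofReal_im,
            Complex.im_ofReal_mul, Complex.I_im, mul_one, zero_add, neg_lt_zero, neg_nonneg]
            using this⟩)
    have h4 := h3.add_const (Real.pi * Complex.I)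
    refine (h4.congr fun x => by rfl).trans_eq ?_
    simp
    ring
  have h3 := h1.sub h2
  have h4 : Tendsto (fun x : ℝ => (∫ t in -T..T, (γ t - p)⁻¹ * deriv γ t) -
      cutLog ((p + T * Complex.I) / (p - T * Complex.I))) atBot
      (𝓝 (0 - 2 * Real.pi * Complex.I)) := by
    refine h3.congr' ?_
    filter_upwards [eventually_lt_atBot 0, eventually_lt_atBot (-R)] with x hx0 hxR
    refine h.integral_inv_sub_sub_cutLog_eq hT0 hT (hR x (by simpa using hx0) ?_)
    rw [Complex.norm_real, Real.norm_of_nonpos hx0.le]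
    linarith
  linear_combination tendsto_nhds_unique tendsto_const_nhds h4

end IsImaginaryPath

/-! ### The rectangular comparison path -/

/-- The points on the rectangular path from `T i` via `c + T i` and `c - T i` to `-T i`. -/
def rectSet (c T : ℝ) : Set ℂ := uIcc 0 c ×ℂ {T, -T} ∪ {c} ×ℂ uIcc (-T) T

/-- The integral along the rectangular path from `T i` via `c + T i` and `c - T i` to `-T i`. -/
noncomputable def rectIntegral (c T : ℝ) (f : ℂ → ℂ) : ℂ :=
  (∫ x in (0)..c, f (x + T * Complex.I)) + (∫ t in -T..T, f (c - t * Complex.I) * -Complex.I) +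
    ∫ x in c..0, f (x - T * Complex.I)

section rectIntegral

variable {c T : ℝ}

theorem top_mem_rectSet {x : ℝ} (hx : x ∈ uIcc 0 c) : (x + T * Complex.I : ℂ) ∈ rectSet c T :=
  Or.inl ⟨by simpa using hx, by simp⟩

theorem bottom_mem_rectSet {x : ℝ} (hx : x ∈ uIcc c 0) : (x - T * Complex.I : ℂ) ∈ rectSet c T :=
  Or.inl ⟨by rw [uIcc_comm] at hx; simpa using hx, by simp⟩

theorem side_mem_rectSet {t : ℝ} (ht : t ∈ uIcc (-T) T) :
    (c - t * Complex.I : ℂ) ∈ rectSet c T := by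
  refine Or.inr ⟨by simp, ?_⟩
  have h : -t ∈ uIcc (-T) T := by
    have := neg_mem_neg.2 ht
    rwa [neg_uIcc, neg_neg, uIcc_comm] at this
  simpa using h

theorem isCompact_rectSet : IsCompact (rectSet c T) :=
  (isCompact_uIcc.reProdIm (toFinite _).isCompact).union
    (isCompact_singleton.reProdIm isCompact_uIcc)

theorem intervalIntegrable_top {f : ℂ → ℂ} (hf : ContinuousOn f (rectSet c T)) :
    IntervalIntegrable (fun x : ℝ => f (x + T * Complex.I)) volume 0 c :=
  (hf.comp (by fun_prop) fun _ hx => top_mem_rectSet hx).intervalIntegrable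

theorem intervalIntegrable_bottom {f : ℂ → ℂ} (hf : ContinuousOn f (rectSet c T)) :
    IntervalIntegrable (fun x : ℝ => f (x - T * Complex.I)) volume c 0 :=
  (hf.comp (by fun_prop) fun _ hx => bottom_mem_rectSet hx).intervalIntegrable

theorem intervalIntegrable_side {f : ℂ → ℂ} (hf : ContinuousOn f (rectSet c T)) :
    IntervalIntegrable (fun t : ℝ => f (c - t * Complex.I) * -Complex.I) volume (-T) T :=
  ((hf.comp (f := fun t : ℝ => (c - t * Complex.I : ℂ)) (by fun_prop)
    fun _ hx => side_mem_rectSet hx).mul continuousOn_const).intervalIntegrable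

theorem rectIntegral_congr {f g : ℂ → ℂ} (hfg : EqOn f g (rectSet c T)) :
    rectIntegral c T f = rectIntegral c T g := by
  simp only [rectIntegral]
  congr 1
  · congr 1
    · exact intervalIntegral.integral_congr fun t ht => hfg (top_mem_rectSet ht)
    · exact intervalIntegral.integral_congr fun t ht => by simp only [hfg (side_mem_rectSet ht)]
  · exact intervalIntegral.integral_congr fun t ht => hfg (bottom_mem_rectSet ht)

theorem rectIntegral_eq_sub {F f : ℂ → ℂ} (hf : ContinuousOn f (rectSet c T))
    (hF : ∀ s ∈ rectSet c T, HasDerivAt F (f s) s) :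
    rectIntegral c T f = F (-(T * Complex.I)) - F (T * Complex.I) := by
  have e2 : ∫ x in (0)..c, f (x + T * Complex.I) = _ :=
    intervalIntegral.integral_eq_sub_of_hasDerivAt
      (f := fun x : ℝ => F (x + T * Complex.I)) (fun x hx => by
        simpa [Function.comp_def] using (hF _ (top_mem_rectSet hx)).comp x
          ((Complex.ofRealCLM.hasDerivAt (x := x)).add_const (T * Complex.I)))
      (intervalIntegrable_top hf)
  have e3 : ∫ x in c..0, f (x - T * Complex.I) = _ :=
    intervalIntegral.integral_eq_sub_of_hasDerivAt
      (f := fun x : ℝ => F (x - T * Complex.I)) (fun x hx => by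
        simpa [Function.comp_def] using (hF _ (bottom_mem_rectSet hx)).comp x
          ((Complex.ofRealCLM.hasDerivAt (x := x)).sub_const (T * Complex.I)))
      (intervalIntegrable_bottom hf)
  have e4 : ∫ t in -T..T, f (c - t * Complex.I) * -Complex.I = _ :=
    intervalIntegral.integral_eq_sub_of_hasDerivAt
      (f := fun t : ℝ => F (c - t * Complex.I)) (fun x hx => by
        simpa [Function.comp_def] using (hF _ (side_mem_rectSet hx)).comp x
          (((Complex.ofRealCLM.hasDerivAt (x := x)).mul_const Complex.I).const_sub (c : ℂ)))
      (intervalIntegrable_side hf)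
  rw [rectIntegral, e2, e3, e4]
  push_cast
  ring_nf

theorem cutLog_eq_of_exp_eq {w z : ℂ} (h : Complex.exp w = z) (h0 : 0 < w.im)
    (h1 : w.im < 2 * Real.pi) : cutLog z = w := by
  rw [← h, cutLog_exp h0 h1]

theorem im_log_pos {z : ℂ} (hz : 0 < z.im) :
    0 < (Complex.log z).im ∧ (Complex.log z).im < Real.pi := by
  rw [Complex.log_im]
  exact ⟨lt_of_le_of_ne (Complex.arg_nonneg_iff.2 hz.le) fun h =>
      hz.ne' (Complex.arg_eq_zero_iff.1 h.symm).2,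
    Complex.arg_lt_pi_iff.2 (Or.inr hz.ne')⟩

theorem im_log_neg {z : ℂ} (hz : z.im < 0) :
    (Complex.log z).im < 0 ∧ -Real.pi < (Complex.log z).im := by
  rw [Complex.log_im]
  exact ⟨Complex.arg_neg_iff.2 hz, Complex.neg_pi_lt_arg z⟩

theorem continuousOn_inv_sub {p : ℂ} {K : Set ℂ} (hp : p ∉ K) (k : ℕ) :
    ContinuousOn (fun s => ((s - p) ^ k)⁻¹) K :=
  ((continuousOn_id.sub continuousOn_const).pow k).inv₀ fun s hs => pow_ne_zero k
    (sub_ne_zero.2 fun h : s = p => hp (h ▸ hs))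

/-- On the path `p - s` avoids the slit, so `log (p - s)` is a primitive. Its increment has
imaginary part in `(0, 2π)`, which identifies it with `cutLog`. The value is the one found for `γ`
when `p` lies to the right of `γ`. -/
theorem rectIntegral_inv_sub_of_lt {p : ℂ} (hc : c < p.re) (hT : |p.im| < T) :
    rectIntegral c T (fun s => (s - p)⁻¹) =
      cutLog ((p + T * Complex.I) / (p - T * Complex.I)) := by
  rw [abs_lt] at hT
  have hsl : ∀ s ∈ rectSet c T, p - s ∈ Complex.slitPlane := by
    rintro s (⟨-, h | h⟩ | ⟨h, -⟩)
    · exact Or.inr (by rw [Complex.sub_im, show s.im = T from h]; linarith)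
    · exact Or.inr (by rw [Complex.sub_im, show s.im = -T from h]; linarith)
    · exact Or.inl (by rw [Complex.sub_re, show s.re = c from h]; linarith)
  have hp : p ∉ rectSet c T := fun h => by simpa using hsl p h
  rw [rectIntegral_eq_sub (F := fun s => Complex.log (p - s))
    (by simpa using continuousOn_inv_sub hp 1) fun s hs => by
      have := ((hasDerivAt_id s).const_sub p).clog (hsl s hs)
      have e : -1 / (p - s) = (s - p)⁻¹ := by rw [← neg_sub s p, neg_div_neg_eq, one_div]
      rwa [id, e] at this]
  have h1 := im_log_pos (z := p + T * Complex.I) (by simp; linarith)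
  have h2 := im_log_neg (z := p - T * Complex.I) (by simp; linarith)
  rw [sub_neg_eq_add]
  refine (cutLog_eq_of_exp_eq ?_ ?_ ?_).symm
  · rw [Complex.exp_sub, Complex.exp_log, Complex.exp_log]
    · intro h; simp [h] at h2
    · intro h; simp [h] at h1
  · rw [Complex.sub_im]; linarith
  · rw [Complex.sub_im]; linarith

/-- Here `log (s - p)` is the primitive. Its increment has imaginary part in `(-2π, 0)`, hence the
correction by `2πi`, as for a point to the left of `γ`. -/
theorem rectIntegral_inv_sub_of_gt {p : ℂ} (hc : p.re < c) (hT : |p.im| < T) :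
    rectIntegral c T (fun s => (s - p)⁻¹) =
      cutLog ((p + T * Complex.I) / (p - T * Complex.I)) - 2 * Real.pi * Complex.I := by
  rw [abs_lt] at hT
  have hsl : ∀ s ∈ rectSet c T, s - p ∈ Complex.slitPlane := by
    rintro s (⟨-, h | h⟩ | ⟨h, -⟩)
    · exact Or.inr (by rw [Complex.sub_im, show s.im = T from h]; linarith)
    · exact Or.inr (by rw [Complex.sub_im, show s.im = -T from h]; linarith)
    · exact Or.inl (by rw [Complex.sub_re, show s.re = c from h]; linarith)
  have hp : p ∉ rectSet c T := fun h => by simpa using hsl p h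
  rw [rectIntegral_eq_sub (F := fun s => Complex.log (s - p))
    (by simpa using continuousOn_inv_sub hp 1) fun s hs => by
      have := ((hasDerivAt_id s).sub_const p).clog (hsl s hs)
      simpa using this]
  have h1 := im_log_pos (z := T * Complex.I - p) (by simp; linarith)
  have h2 := im_log_neg (z := -(T * Complex.I) - p) (by simp; linarith)
  rw [eq_sub_iff_add_eq]
  refine (cutLog_eq_of_exp_eq ?_ ?_ ?_).symm
  · rw [Complex.exp_add, Complex.exp_sub, Complex.exp_two_pi_mul_I, mul_one, Complex.exp_log,
      Complex.exp_log, ← neg_div_neg_eq]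
    · congr 1 <;> ring
    · intro h; simp [h] at h1
    · intro h; simp [h] at h2
  · simp; linarith
  · simp; linarith

end rectIntegral

/-! ### Comparison of the two paths for meromorphic functions -/

/-- The points on the part `[-T, T]` of the path `γ` and on the rectangular path with the same
end points. -/
def boundarySet (γ : ℝ → ℂ) (c T : ℝ) : Set ℂ := γ '' uIcc (-T) T ∪ rectSet c T

/-- The integral of `f` along the part `[-T, T]` of the path `γ` minus its integral along the
rectangular path with the same end points. -/
noncomputable def deviation (γ : ℝ → ℂ) (c T : ℝ) (f : ℂ → ℂ) : ℂ :=
  (∫ t in -T..T, f (γ t) * deriv γ t) - rectIntegral c T f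

section deviation

variable {γ : ℝ → ℂ} {c T : ℝ}

theorem image_subset_boundarySet : γ '' uIcc (-T) T ⊆ boundarySet γ c T := subset_union_left

theorem rectSet_subset_boundarySet : rectSet c T ⊆ boundarySet γ c T := subset_union_right

theorem isCompact_boundarySet (hγ : Continuous γ) : IsCompact (boundarySet γ c T) :=
  (isCompact_uIcc.image hγ).union isCompact_rectSet

theorem intervalIntegrable_path (h : IsImaginaryPath γ) {f : ℂ → ℂ}
    (hf : ContinuousOn f (boundarySet γ c T)) :
    IntervalIntegrable (fun t => f (γ t) * deriv γ t) volume (-T) T :=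
  h.intervalIntegrable_mul_deriv (hf.comp h.continuous.continuousOn
    fun _ ht => image_subset_boundarySet (mem_image_of_mem γ ht))

theorem deviation_congr {f g : ℂ → ℂ} (hfg : EqOn f g (boundarySet γ c T)) :
    deviation γ c T f = deviation γ c T g := by
  simp only [deviation]
  congr 1
  · exact intervalIntegral.integral_congr fun t ht => by
      simp only [hfg (image_subset_boundarySet (mem_image_of_mem γ ht))]
  · exact rectIntegral_congr (hfg.mono rectSet_subset_boundarySet)

theorem deviation_add (h : IsImaginaryPath γ) {f g : ℂ → ℂ}
    (hf : ContinuousOn f (boundarySet γ c T)) (hg : ContinuousOn g (boundarySet γ c T)) :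
    deviation γ c T (fun s => f s + g s) = deviation γ c T f + deviation γ c T g := by
  have hf' := hf.mono rectSet_subset_boundarySet
  have hg' := hg.mono rectSet_subset_boundarySet
  simp only [deviation, rectIntegral, add_mul]
  rw [intervalIntegral.integral_add (intervalIntegrable_path h hf) (intervalIntegrable_path h hg),
    intervalIntegral.integral_add (intervalIntegrable_top hf') (intervalIntegrable_top hg'),
    intervalIntegral.integral_add (intervalIntegrable_side hf') (intervalIntegrable_side hg'),
    intervalIntegral.integral_add (intervalIntegrable_bottom hf') (intervalIntegrable_bottom hg')]
  ring

theorem deviation_const_mul (a : ℂ) (f : ℂ → ℂ) :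
    deviation γ c T (fun s => a * f s) = a * deviation γ c T f := by
  simp only [deviation, rectIntegral, mul_assoc, intervalIntegral.integral_const_mul]
  ring

theorem deviation_sum (h : IsImaginaryPath γ) (N : ℕ) {f : ℕ → ℂ → ℂ}
    (hf : ∀ k, ContinuousOn (f k) (boundarySet γ c T)) :
    deviation γ c T (fun s => ∑ k ∈ Finset.range N, f k s) =
      ∑ k ∈ Finset.range N, deviation γ c T (f k) := by
  induction N with
  | zero => simp [deviation, rectIntegral]
  | succ N ih =>
    simp only [Finset.sum_range_succ]
    rw [deviation_add h (continuousOn_finsetSum _ fun k _ => hf k) (hf N), ih]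

theorem deviation_eq_zero_of_hasDerivAt (h : IsImaginaryPath γ)
    (hT : ∀ t : ℝ, T ≤ |t| → γ t = -(t * Complex.I)) {F f : ℂ → ℂ}
    (hf : ContinuousOn f (boundarySet γ c T)) (hF : ∀ s ∈ boundarySet γ c T, HasDerivAt F (f s) s) :
    deviation γ c T f = 0 := by
  have hγ1 : γ (-T) = T * Complex.I := by
    rw [hT _ (by rw [abs_neg]; exact le_abs_self T)]; push_cast; ring
  have hγ2 : γ T = -(T * Complex.I) := hT _ (le_abs_self T)
  rw [deviation, h.integral_eq_sub (hf.mono image_subset_boundarySet)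
    fun s hs => hF s (image_subset_boundarySet hs),
    rectIntegral_eq_sub (hf.mono rectSet_subset_boundarySet)
    fun s hs => hF s (rectSet_subset_boundarySet hs), hγ1, hγ2, sub_self]

/-- The point `p` lies on the same side of the path `γ` and of the line `Re s = c`. -/
def SameSide (γ : ℝ → ℂ) (c : ℝ) (p : ℂ) : Prop :=
  (p ∈ leftSide γ ∧ p.re < c) ∨ (p ∈ rightSide γ ∧ c < p.re)

theorem SameSide.notMem_boundarySet {p : ℂ} (hp : SameSide γ c p) (hT : |p.im| < T) :
    p ∉ boundarySet γ c T := by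
  rintro (h | h | h)
  · have hr := image_subset_range _ _ h
    rcases hp with hp | hp
    · exact notMem_range_of_mem_leftSide hp.1 hr
    · exact notMem_range_of_mem_rightSide hp.1 hr
  · rw [abs_lt] at hT
    rcases h.2 with h | h
    · exact hT.2.ne h
    · exact hT.1.ne' h
  · have hr : p.re = c := h.1
    rcases hp with hp | hp <;> linarith [hp.2]

theorem SameSide.deviation_inv_sub {p : ℂ} (h : IsImaginaryPath γ) (hp : SameSide γ c p)
    (hT : ∀ t : ℝ, T ≤ |t| → γ t = -(t * Complex.I)) (hpT : |p.im| < T) :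
    deviation γ c T (fun s => (s - p)⁻¹) = 0 := by
  have hT0 : 0 < T := (abs_nonneg _).trans_lt hpT
  rcases hp with ⟨hp, hc⟩ | ⟨hp, hc⟩
  · rw [deviation, h.integral_inv_sub_of_mem_leftSide hT0 hT hp, rectIntegral_inv_sub_of_gt hc hpT,
      sub_self]
  · rw [deviation, h.integral_inv_sub_of_mem_rightSide hT0 hT hp, rectIntegral_inv_sub_of_lt hc hpT,
      sub_self]

end deviation

/-- A meromorphic function is the sum of an analytic function and a principal part. -/
theorem exists_principalPart {f : ℂ → ℂ} {p : ℂ} (hf : MeromorphicAt f p) :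
    ∃ (N : ℕ) (a : ℕ → ℂ) (g : ℂ → ℂ), AnalyticAt ℂ g p ∧
      ∀ᶠ s in 𝓝[≠] p, f s = g s + ∑ k ∈ Finset.range N, a k * ((s - p) ^ (k + 1))⁻¹ := by
  obtain ⟨N, hN⟩ := hf
  have key : ∀ (N : ℕ) (f h : ℂ → ℂ), AnalyticAt ℂ h p →
      (∀ᶠ s in 𝓝[≠] p, f s = h s * ((s - p) ^ N)⁻¹) →
      ∃ (a : ℕ → ℂ) (g : ℂ → ℂ), AnalyticAt ℂ g p ∧
      ∀ᶠ s in 𝓝[≠] p, f s = g s + ∑ k ∈ Finset.range N, a k * ((s - p) ^ (k + 1))⁻¹ := by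
    intro N
    induction N with
    | zero => exact fun f h hh hf => ⟨0, h, hh, by simpa using hf⟩
    | succ N ih =>
      intro f h hh hf
      obtain ⟨q, hq⟩ := hh
      -- Write `h s = h p + (s - p) * dslope h p s`: the first summand gives the coefficient of
      -- order `N + 1`, the second leaves a pole of order at most `N`.
      have hd : AnalyticAt ℂ (dslope h p) p := ⟨_, hq.has_fpower_series_dslope_fslope⟩
      obtain ⟨a, g, hg, hfg⟩ := ih (fun s => dslope h p s * ((s - p) ^ N)⁻¹) _ hd (by simp)
      refine ⟨fun k => if k = N then h p else a k, g, hg, ?_⟩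
      filter_upwards [hf, hfg, self_mem_nhdsWithin] with s hs1 hs2 hs3
      rw [Finset.sum_range_succ, hs1]
      have h1 : ∑ k ∈ Finset.range N, (if k = N then h p else a k) * ((s - p) ^ (k + 1))⁻¹ =
          ∑ k ∈ Finset.range N, a k * ((s - p) ^ (k + 1))⁻¹ :=
        Finset.sum_congr rfl fun k hk => by rw [if_neg (Finset.mem_range.1 hk).ne]
      rw [h1, ← add_assoc, ← hs2, if_pos rfl]
      have h2 : s - p ≠ 0 := sub_ne_zero.2 hs3
      rw [dslope_of_ne _ hs3, slope_def_field]
      field_simp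
      ring
  obtain ⟨a, g, hg, h⟩ := key N f _ hN (by
    filter_upwards [self_mem_nhdsWithin] with s hs
    have : s - p ≠ 0 := sub_ne_zero.2 hs
    simp only [smul_eq_mul]
    field_simp)
  exact ⟨N, a, g, hg, h⟩

/-- The integrals along `γ` and along the rectangular path agree for a meromorphic function whose
poles lie on the same side of both. -/
theorem deviation_eq_zero {γ : ℝ → ℂ} (h : IsImaginaryPath γ) {c T R : ℝ}
    (hT : ∀ t : ℝ, T ≤ |t| → γ t = -(t * Complex.I))
    (hK : boundarySet γ c T ⊆ Metric.ball 0 R) (P : Finset ℂ)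
    (hP : ∀ p ∈ P, SameSide γ c p ∧ |p.im| < T) {f : ℂ → ℂ}
    (hf : ∀ s ∈ Metric.ball 0 R, s ∉ P → DifferentiableAt ℂ f s)
    (hm : ∀ p ∈ P, MeromorphicAt f p) : deviation γ c T f = 0 := by
  induction P using Finset.induction_on generalizing f with
  | empty =>
    have hd : DifferentiableOn ℂ f (Metric.ball 0 R) :=
      fun s hs => (hf s hs (Finset.notMem_empty s)).differentiableWithinAt
    obtain ⟨F, hF⟩ := hd.isExactOn_ball
    exact deviation_eq_zero_of_hasDerivAt h hT (hd.continuousOn.mono hK) fun s hs => hF s (hK hs)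
  | insert p P hpP ih =>
    obtain ⟨N, a, g, hg, hfg⟩ := exists_principalPart (hm p (Finset.mem_insert_self p P))
    set q : ℂ → ℂ := fun s => ∑ k ∈ Finset.range N, a k * ((s - p) ^ (k + 1))⁻¹ with hq
    have hqd : ∀ s ≠ p, DifferentiableAt ℂ q s := fun s hs =>
      DifferentiableAt.fun_sum fun k _ => DifferentiableAt.const_mul (DifferentiableAt.fun_inv
        ((differentiableAt_id.sub_const p).fun_pow (k + 1)) (pow_ne_zero _ (sub_ne_zero.2 hs))) _
    -- Subtract the principal part and fill in the value `g p`, so that `f₁` is holomorphic at `p`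
    -- and has one exceptional point fewer.
    set f₁ : ℂ → ℂ := Function.update (fun s => f s - q s) p (g p) with hf₁
    have hev : f₁ =ᶠ[𝓝 p] g := by
      rw [eventually_nhdsWithin_iff] at hfg
      filter_upwards [hfg] with s hs
      by_cases hsp : s = p
      · rw [hsp, hf₁, Function.update_self]
      · rw [hf₁, Function.update_of_ne hsp, hs hsp]
        ring
    have hev' : ∀ s ≠ p, f₁ =ᶠ[𝓝 s] fun s => f s - q s := fun s hs => by
      filter_upwards [isOpen_ne.mem_nhds hs] with w hw
      rw [hf₁, Function.update_of_ne hw]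
    obtain ⟨hps, hpT⟩ := hP p (Finset.mem_insert_self p P)
    have hpK := hps.notMem_boundarySet hpT
    have hcont : ∀ k : ℕ, ContinuousOn (fun s => ((s - p) ^ (k + 1))⁻¹) (boundarySet γ c T) :=
      fun k => continuousOn_inv_sub hpK (k + 1)
    have hd₁ : ∀ s ∈ Metric.ball 0 R, s ∉ P → DifferentiableAt ℂ f₁ s := by
      intro s hs hsP
      by_cases hsp : s = p
      · subst hsp
        exact hev.differentiableAt_iff.2 hg.differentiableAt
      · exact (hev' s hsp).differentiableAt_iff.2
          ((hf s hs (by simp [hsp, hsP])).fun_sub (hqd s hsp))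
    have hdev₁ : deviation γ c T f₁ = 0 := by
      refine ih (fun p' hp' => hP p' (Finset.mem_insert_of_mem hp')) hd₁ fun p' hp' => ?_
      have hne : p' ≠ p := fun e => hpP (e ▸ hp')
      have hmer : MeromorphicAt q p' := by
        refine AnalyticAt.meromorphicAt ?_
        refine DifferentiableOn.analyticAt (s := {p}ᶜ) (fun s hs =>
          (hqd s hs).differentiableWithinAt) (isOpen_ne.mem_nhds hne)
      exact ((hm p' (Finset.mem_insert_of_mem hp')).sub hmer).congr
        ((hev' p' hne).symm.filter_mono nhdsWithin_le_nhds)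
    have hf₁K : ContinuousOn f₁ (boundarySet γ c T) := fun s hs =>
      (hd₁ s (hK hs) fun hsP => (hP s (Finset.mem_insert_of_mem hsP)).1.notMem_boundarySet
        (hP s (Finset.mem_insert_of_mem hsP)).2 hs).continuousAt.continuousWithinAt
    have hsplit : EqOn f (fun s => f₁ s + q s) (boundarySet γ c T) := by
      intro s hs
      have hsp : s ≠ p := fun e => hpK (e ▸ hs)
      simp [hf₁, Function.update_of_ne hsp]
    have hcont' : ∀ k : ℕ, ContinuousOn (fun s => a k * ((s - p) ^ (k + 1))⁻¹)
        (boundarySet γ c T) := fun k => continuousOn_const.mul (hcont k)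
    have hqK : ContinuousOn q (boundarySet γ c T) := continuousOn_finsetSum _ fun k _ => hcont' k
    rw [deviation_congr hsplit, deviation_add h hf₁K hqK, hdev₁, zero_add, hq,
      deviation_sum h N hcont']
    refine Finset.sum_eq_zero fun k _ => ?_
    rw [deviation_const_mul]
    -- The residue term is covered by the logarithm computation; all higher-order terms have
    -- primitives.
    rcases k with _ | k
    · have := hps.deviation_inv_sub h hT hpT
      simp [this]
    · rw [deviation_eq_zero_of_hasDerivAt h hT (hcont (k + 1))
        (F := fun s => -((k : ℂ) + 1)⁻¹ * ((s - p) ^ (k + 1))⁻¹), mul_zero]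
      intro s hs
      have hsp : s - p ≠ 0 := sub_ne_zero.2 fun e => hpK (e ▸ hs)
      have h1 := ((((hasDerivAt_id s).sub_const p).fun_pow (k + 1)).fun_inv
        (pow_ne_zero _ hsp)).const_mul (-((k : ℂ) + 1)⁻¹)
      refine h1.congr_deriv ?_
      have : (k : ℂ) + 1 ≠ 0 := by exact_mod_cast k.succ_ne_zero
      simp only [id, Nat.add_sub_cancel]
      push_cast
      field_simp
      ring

/-! ### Growth of gamma factors on vertical strips -/

theorem norm_betaIntegral_le_one {u v : ℂ} (hu : 1 ≤ u.re) (hv : 1 ≤ v.re) :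
    ‖Complex.betaIntegral u v‖ ≤ 1 := by
  have h : ∀ (w : ℂ), 1 ≤ w.re → ∀ x : ℝ, 0 ≤ x → x ≤ 1 → ‖(x : ℂ) ^ (w - 1)‖ ≤ 1 := by
    intro w hw x h0 h1
    rcases h0.eq_or_lt with rfl | h0
    · by_cases hw1 : w - 1 = 0
      · simp [hw1]
      · simp [Complex.zero_cpow hw1]
    · rw [Complex.norm_cpow_eq_rpow_re_of_pos h0]
      exact Real.rpow_le_one h0.le h1 (by simpa using hw)
  have := intervalIntegral.norm_integral_le_of_norm_le_const (a := 0) (b := 1) (C := 1)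
    (f := fun x : ℝ => (x : ℂ) ^ (u - 1) * (1 - (x : ℂ)) ^ (v - 1)) (fun x hx => by
      rw [uIoc_of_le zero_le_one] at hx
      have h1 := h v hv (1 - x) (by linarith [hx.2]) (by linarith [hx.1])
      rw [Complex.ofReal_sub, Complex.ofReal_one] at h1
      rw [norm_mul]
      exact mul_le_one₀ (h u hu x hx.1.le hx.2) (norm_nonneg _) h1)
  simpa [Complex.betaIntegral] using this

/-- `Γ(u) Γ(v) = Γ(u + v) B(u, v)` with `|B| ≤ 1`. This elementary inequality takes the place of
Stirling's formula. -/
theorem norm_Gamma_mul_norm_Gamma_le {u v : ℂ} (hu : 1 ≤ u.re) (hv : 1 ≤ v.re) :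
    ‖Complex.Gamma u‖ * ‖Complex.Gamma v‖ ≤ ‖Complex.Gamma (u + v)‖ := by
  rw [← norm_mul, Complex.Gamma_mul_Gamma_eq_betaIntegral (by linarith) (by linarith), norm_mul]
  exact mul_le_of_le_one_right (norm_nonneg _) (norm_betaIntegral_le_one hu hv)

theorem Gamma_add_nat_eq_prod (K : ℕ) {s : ℂ} (hs : ∀ m : ℕ, s ≠ -m) :
    Complex.Gamma (s + K) = Complex.Gamma s * ∏ i ∈ Finset.range K, (s + i) := by
  induction K with
  | zero => simp
  | succ K ih =>
    have h : s + K ≠ 0 := fun h => hs K (by linear_combination h)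
    rw [Nat.cast_succ, ← add_assoc, Complex.Gamma_add_one _ h, ih, Finset.prod_range_succ]
    ring

/-- The dominant exponential is at least 2 and the other one at most 1, so their difference is at
least half the dominant one. -/
theorem exp_abs_im_le_norm_sin {z : ℂ} (hz : 1 ≤ |z.im|) :
    Real.exp |z.im| / 4 ≤ ‖Complex.sin z‖ := by
  have h1 : ‖Complex.exp (-z * Complex.I)‖ = Real.exp z.im := by simp [Complex.norm_exp]
  have h2 : ‖Complex.exp (z * Complex.I)‖ = Real.exp (-z.im) := by simp [Complex.norm_exp]
  have h3 : ‖Complex.sin z‖ = ‖Complex.exp (-z * Complex.I) - Complex.exp (z * Complex.I)‖ / 2 := by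
    rw [Complex.sin]
    simp
  have h4 : |Real.exp z.im - Real.exp (-z.im)| = Real.exp |z.im| - Real.exp (-|z.im|) := by
    rcases abs_cases z.im with ⟨h, h'⟩ | ⟨h, h'⟩
    · rw [h, abs_of_nonneg]
      simpa using by linarith
    · rw [h, neg_neg, abs_of_nonpos]
      · ring
      · simpa using by linarith
  have h5 := abs_norm_sub_norm_le (Complex.exp (-z * Complex.I)) (Complex.exp (z * Complex.I))
  rw [h1, h2, h4] at h5
  have h6 : Real.exp (-|z.im|) ≤ 1 := Real.exp_le_one_iff.2 (by linarith)
  have h7 : 2 ≤ Real.exp |z.im| := by linarith [Real.add_one_le_exp |z.im|]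
  rw [h3]
  linarith

/-- On the strip `a ≤ Re s ≤ b`, the function `f` is for large `|Im s|` bounded by a power of
`1 + |s|` times `exp (-κ |Im s|)`. -/
def StripBound (a b κ : ℝ) (f : ℂ → ℂ) : Prop :=
  ∃ (C : ℝ) (N : ℕ) (Y : ℝ), 0 ≤ C ∧ ∀ s : ℂ, s.re ∈ Icc a b → Y ≤ |s.im| →
    ‖f s‖ ≤ C * (1 + ‖s‖) ^ N * Real.exp (-κ * |s.im|)

namespace StripBound

variable {a b κ κ' : ℝ} {f g : ℂ → ℂ}

theorem mul (hf : StripBound a b κ f) (hg : StripBound a b κ' g) :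
    StripBound a b (κ + κ') fun s => f s * g s := by
  obtain ⟨C, N, Y, hC, h⟩ := hf
  obtain ⟨C', N', Y', hC', h'⟩ := hg
  refine ⟨C * C', N + N', max Y Y', by positivity, fun s hs hY => ?_⟩
  calc ‖f s * g s‖ = ‖f s‖ * ‖g s‖ := norm_mul _ _
    _ ≤ (C * (1 + ‖s‖) ^ N * Real.exp (-κ * |s.im|)) *
        (C' * (1 + ‖s‖) ^ N' * Real.exp (-κ' * |s.im|)) := by
      gcongr
      · exact h s hs ((le_max_left _ _).trans hY)
      · exact h' s hs ((le_max_right _ _).trans hY)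
    _ = _ := by
      rw [pow_add, show -(κ + κ') * |s.im| = -κ * |s.im| + -κ' * |s.im| by ring, Real.exp_add]
      ring

theorem prod {ι : Type*} (t : Finset ι) {f : ι → ℂ → ℂ} (hf : ∀ i ∈ t, StripBound a b κ (f i)) :
    StripBound a b (t.card * κ) fun s => ∏ i ∈ t, f i s := by
  classical
  induction t using Finset.induction_on with
  | empty => exact ⟨1, 0, 0, zero_le_one, by simp⟩
  | insert i t hi ih =>
    simp only [Finset.prod_insert hi]
    rw [Finset.card_insert_of_notMem hi, Nat.cast_succ, add_one_mul, add_comm]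
    exact (hf i (Finset.mem_insert_self i t)).mul
      (ih fun j hj => hf j (Finset.mem_insert_of_mem hj))

theorem polynomial (P : Polynomial ℂ) : StripBound a b 0 fun s => P.eval s := by
  induction P using Polynomial.induction_on' with
  | add p q hp hq =>
    obtain ⟨C, N, Y, hC, h⟩ := hp
    obtain ⟨C', N', Y', hC', h'⟩ := hq
    refine ⟨C + C', max N N', max Y Y', by positivity, fun s hs hY => ?_⟩
    have h1 := h s hs ((le_max_left _ _).trans hY)
    have h2 := h' s hs ((le_max_right _ _).trans hY)
    have h3 : (1 : ℝ) ≤ 1 + ‖s‖ := by linarith [norm_nonneg s]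
    have h4 : (1 + ‖s‖) ^ N ≤ (1 + ‖s‖) ^ max N N' := pow_le_pow_right₀ h3 (le_max_left _ _)
    have h5 : (1 + ‖s‖) ^ N' ≤ (1 + ‖s‖) ^ max N N' := pow_le_pow_right₀ h3 (le_max_right _ _)
    simp only [neg_zero, zero_mul, Real.exp_zero, mul_one, Polynomial.eval_add] at h1 h2 ⊢
    calc _ ≤ _ := norm_add_le _ _
      _ ≤ C * (1 + ‖s‖) ^ N + C' * (1 + ‖s‖) ^ N' := add_le_add h1 h2
      _ ≤ C * (1 + ‖s‖) ^ max N N' + C' * (1 + ‖s‖) ^ max N N' := by gcongr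
      _ = _ := by ring
  | monomial N c =>
    refine ⟨‖c‖, N, 0, norm_nonneg c, fun s _ _ => ?_⟩
    simp only [Polynomial.eval_monomial, norm_mul, norm_pow, neg_zero, zero_mul, Real.exp_zero,
      mul_one]
    gcongr
    linarith

/-- Exponential decay on vertical strips of a product of two gamma functions of opposite
arguments. -/
theorem Gamma_mul_Gamma (x y : ℂ) :
    StripBound a b Real.pi fun s => Complex.Gamma (x + s) * Complex.Gamma (y - s) := by
  obtain ⟨K, hK⟩ := exists_nat_ge (1 - y.re + b)
  obtain ⟨M, hM⟩ := exists_nat_ge ((x + y).re)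
  -- Chosen so that `(y - s + K) + v = 1 - (x + s) + (K + M)`. Multiplying by the constant `Γ(v)`
  -- thus trades `Γ(y - s)` for `Γ(1 - (x + s))` times a polynomial, and the latter meets `Γ(x + s)`
  -- in the reflection formula. `K` and `M` bring both real parts up to 1.
  set v : ℂ := M - (x + y - 1) with hv
  have hvre : 1 ≤ v.re := by
    simp only [hv, Complex.sub_re, Complex.natCast_re, Complex.one_re]
    linarith
  have hΓv : 0 < ‖Complex.Gamma v‖ :=
    norm_pos_iff.2 (Complex.Gamma_ne_zero_of_re_pos (by linarith))
  refine ⟨Real.pi * 4 * Real.exp (Real.pi * |x.im|) * (1 + ‖x‖ + (K + M : ℕ)) ^ (K + M) /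
    ‖Complex.Gamma v‖, K + M, 1 + |x.im| + |y.im|, by positivity, fun s hs hY => ?_⟩
  have hA : |s.im| - |x.im| ≤ |(x + s).im| := by
    have := abs_sub_abs_le_abs_sub s.im (-x.im)
    rw [abs_neg, sub_neg_eq_add, add_comm s.im] at this
    simpa using this
  have hB : |s.im| - |y.im| ≤ |(y - s).im| := by
    have := abs_sub_abs_le_abs_sub s.im y.im
    rw [abs_sub_comm s.im] at this
    simpa using this
  have hx0 := abs_nonneg x.im
  have hy0 := abs_nonneg y.im
  have hpole : ∀ w : ℂ, 1 ≤ |w.im| → ∀ m : ℕ, w ≠ -m := by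
    rintro w hw m rfl
    norm_num at hw
  -- Each factor `y - s + i` has norm at least 1, by the choice of the threshold for `|Im s|`.
  have hBK : ‖Complex.Gamma (y - s)‖ ≤ ‖Complex.Gamma (y - s + K)‖ := by
    rw [Gamma_add_nat_eq_prod K (hpole _ (by linarith)), norm_mul, norm_prod]
    refine le_mul_of_one_le_right (norm_nonneg _)
      (Finset.prod_induction _ (fun x => 1 ≤ x) (fun _ _ => one_le_mul_of_one_le_of_one_le) le_rfl
        fun i _ => ?_)
    refine le_trans ?_ (Complex.abs_im_le_norm _)
    simp only [Complex.add_im, Complex.natCast_im, add_zero]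
    linarith
  have him : |(1 - (x + s)).im| = |(x + s).im| := by
    rw [Complex.sub_im, Complex.one_im, zero_sub, abs_neg]
  have hG : Complex.Gamma (y - s + K + v) =
      Complex.Gamma (1 - (x + s)) * ∏ i ∈ Finset.range (K + M), (1 - (x + s) + i) := by
    rw [← Gamma_add_nat_eq_prod _ (hpole _ (by rw [him]; linarith)), hv]
    push_cast
    ring_nf
  have hprod : ‖∏ i ∈ Finset.range (K + M), (1 - (x + s) + i)‖ ≤
      ((1 + ‖x‖ + (K + M : ℕ)) * (1 + ‖s‖)) ^ (K + M) := by
    rw [norm_prod]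
    refine (Finset.prod_le_prod (fun _ _ => norm_nonneg _) (g := fun _ =>
      (1 + ‖x‖ + (K + M : ℕ)) * (1 + ‖s‖)) fun i hi => ?_).trans_eq (by simp)
    have h1 : ‖1 - (x + s) + (i : ℂ)‖ ≤ 1 + (‖x‖ + ‖s‖) + i := by
      refine (norm_add_le _ _).trans ?_
      have := norm_sub_le (1 : ℂ) (x + s)
      rw [norm_one] at this
      have := norm_add_le x s
      rw [Complex.norm_natCast]
      linarith
    have h2 : (i : ℝ) ≤ (K + M : ℕ) := by exact_mod_cast (Finset.mem_range.1 hi).le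
    nlinarith [norm_nonneg x, norm_nonneg s, mul_nonneg (norm_nonneg x) (norm_nonneg s),
      mul_nonneg ((Nat.cast_nonneg (K + M) : (0 : ℝ) ≤ (K + M : ℕ))) (norm_nonneg s)]
  have hmain : ‖Complex.Gamma (y - s)‖ * ‖Complex.Gamma v‖ ≤
      ‖Complex.Gamma (1 - (x + s))‖ * ((1 + ‖x‖ + (K + M : ℕ)) * (1 + ‖s‖)) ^ (K + M) := by
    calc _ ≤ ‖Complex.Gamma (y - s + K)‖ * ‖Complex.Gamma v‖ := by gcongr
      _ ≤ ‖Complex.Gamma (y - s + K + v)‖ := norm_Gamma_mul_norm_Gamma_le (by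
        simp only [Complex.add_re, Complex.sub_re, Complex.natCast_re]
        linarith [hs.2]) hvre
      _ ≤ _ := by
        rw [hG, norm_mul]
        gcongr
  have hsin : ‖Complex.Gamma (x + s)‖ * ‖Complex.Gamma (1 - (x + s))‖ ≤
      Real.pi * 4 * Real.exp (Real.pi * |x.im|) * Real.exp (-Real.pi * |s.im|) := by
    rw [← norm_mul, Complex.Gamma_mul_Gamma_one_sub, norm_div, Complex.norm_real,
      Real.norm_of_nonneg Real.pi_pos.le]
    have e : |(Real.pi * (x + s)).im| = Real.pi * |(x + s).im| := by
      rw [Complex.im_ofReal_mul, abs_mul, abs_of_pos Real.pi_pos]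
    have h1 := exp_abs_im_le_norm_sin (z := Real.pi * (x + s)) (by
      rw [e]; nlinarith [Real.pi_gt_three])
    rw [e] at h1
    have h2 : Real.exp (Real.pi * |s.im|) ≤
        Real.exp (Real.pi * |x.im|) * Real.exp (Real.pi * |(x + s).im|) := by
      rw [← Real.exp_add, ← mul_add]
      gcongr
      linarith
    have h3 : 0 < ‖Complex.sin (Real.pi * (x + s))‖ := lt_of_lt_of_le (by positivity) h1
    rw [div_le_iff₀ h3, neg_mul, Real.exp_neg]
    have h4 : Real.exp (Real.pi * |s.im|) ≤
        4 * Real.exp (Real.pi * |x.im|) * ‖Complex.sin (Real.pi * (x + s))‖ := by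
      nlinarith [Real.exp_pos (Real.pi * |x.im|)]
    calc Real.pi = Real.pi * (Real.exp (Real.pi * |s.im|))⁻¹ * Real.exp (Real.pi * |s.im|) := by
          field_simp
      _ ≤ Real.pi * (Real.exp (Real.pi * |s.im|))⁻¹ *
          (4 * Real.exp (Real.pi * |x.im|) * ‖Complex.sin (Real.pi * (x + s))‖) := by gcongr
      _ = _ := by ring
  rw [norm_mul, div_mul_eq_mul_div, div_mul_eq_mul_div, le_div_iff₀ hΓv]
  calc ‖Complex.Gamma (x + s)‖ * ‖Complex.Gamma (y - s)‖ * ‖Complex.Gamma v‖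
      = ‖Complex.Gamma (x + s)‖ * (‖Complex.Gamma (y - s)‖ * ‖Complex.Gamma v‖) := by ring
    _ ≤ ‖Complex.Gamma (x + s)‖ * (‖Complex.Gamma (1 - (x + s))‖ *
        ((1 + ‖x‖ + (K + M : ℕ)) * (1 + ‖s‖)) ^ (K + M)) := by gcongr
    _ = (‖Complex.Gamma (x + s)‖ * ‖Complex.Gamma (1 - (x + s))‖) *
        ((1 + ‖x‖ + (K + M : ℕ)) * (1 + ‖s‖)) ^ (K + M) := by ring
    _ ≤ (Real.pi * 4 * Real.exp (Real.pi * |x.im|) * Real.exp (-Real.pi * |s.im|)) *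
        ((1 + ‖x‖ + (K + M : ℕ)) * (1 + ‖s‖)) ^ (K + M) := by gcongr
    _ = _ := by rw [mul_pow]; ring

end StripBound

/-! ### Exponential decay and passage to a vertical line -/

theorem integrable_exp_neg_mul_abs {δ : ℝ} (hδ : 0 < δ) :
    Integrable fun t : ℝ => Real.exp (-δ * |t|) := by
  rw [← integrableOn_univ, ← Iic_union_Ioi (a := (0 : ℝ))]
  refine IntegrableOn.union ?_ ?_
  · refine (integrableOn_exp_mul_Iic hδ 0).congr_fun (fun t ht => ?_) measurableSet_Iic
    simp only [abs_of_nonpos (mem_Iic.1 ht)]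
    ring_nf
  · refine (integrableOn_exp_mul_Ioi (neg_lt_zero.2 hδ) 0).congr_fun (fun t ht => ?_)
      measurableSet_Ioi
    simp only [abs_of_pos (mem_Ioi.1 ht)]

theorem integrable_of_norm_le_exp_neg_mul_abs {φ : ℝ → ℂ} (hφ : Continuous φ) {C δ Y : ℝ}
    (hδ : 0 < δ) (h : ∀ t, Y ≤ |t| → ‖φ t‖ ≤ C * Real.exp (-δ * |t|)) : Integrable φ := by
  obtain ⟨M, hM⟩ := (isCompact_Icc (a := -|Y|) (b := |Y|)).exists_bound_of_continuousOn
    hφ.continuousOn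
  refine ((integrable_exp_neg_mul_abs hδ).const_mul (max C (M * Real.exp (δ * |Y|)))).mono'
    hφ.aestronglyMeasurable (Eventually.of_forall fun t => ?_)
  by_cases ht : Y ≤ |t|
  · exact (h t ht).trans (by gcongr; exact le_max_left _ _)
  · have hlt : |t| ≤ |Y| := (not_le.1 ht).le.trans (le_abs_self Y)
    have hM0 : 0 ≤ M := (norm_nonneg _).trans (hM 0 (by simp))
    calc ‖φ t‖ ≤ M := hM t (abs_le.1 hlt)
      _ = M * Real.exp (δ * |Y|) * Real.exp (-δ * |Y|) := by
        rw [mul_assoc, ← Real.exp_add]; simp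
      _ ≤ M * Real.exp (δ * |Y|) * Real.exp (-δ * |t|) := by
        gcongr M * Real.exp (δ * |Y|) * Real.exp ?_
        nlinarith
      _ ≤ _ := by gcongr; exact le_max_right _ _

/-- The function `f` decays exponentially for `Im s → ±∞`, uniformly in `x₀ ≤ Re s ≤ x₁`. -/
def VerticalDecay (x₀ x₁ : ℝ) (f : ℂ → ℂ) : Prop :=
  ∃ C δ Y : ℝ, 0 < δ ∧ ∀ s : ℂ, s.re ∈ Icc x₀ x₁ → Y ≤ |s.im| → ‖f s‖ ≤ C * Real.exp (-δ * |s.im|)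

theorem VerticalDecay.integrable_line {c x₀ x₁ : ℝ} {f : ℂ → ℂ} (hd : VerticalDecay x₀ x₁ f)
    (hc : c ∈ Icc x₀ x₁) (hf : ∀ t : ℝ, ContinuousAt f (c - t * Complex.I)) :
    Integrable fun t : ℝ => f (c - t * Complex.I) := by
  obtain ⟨C, δ, Y, hδ, h⟩ := hd
  refine integrable_of_norm_le_exp_neg_mul_abs (continuous_iff_continuousAt.2 fun t =>
    ContinuousAt.comp (g := f) (f := fun t : ℝ => (c - t * Complex.I : ℂ)) (hf t) (by fun_prop)) hδ
    (C := C) (Y := Y) fun t ht => ?_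
  have := h (c - t * Complex.I) (by simpa using hc) (by simpa using ht)
  simpa using this

theorem VerticalDecay.tendsto_integral_horizontal {c x₀ x₁ : ℝ} {f : ℂ → ℂ}
    (hd : VerticalDecay x₀ x₁ f) (hx : uIcc 0 c ⊆ Icc x₀ x₁) {η : ℝ} (hη : |η| = 1) :
    Tendsto (fun T : ℝ => ∫ x in (0)..c, f (x + (η * T : ℝ) * Complex.I)) atTop (𝓝 0) := by
  obtain ⟨C, δ, Y, hδ, h⟩ := hd
  have hlim : Tendsto (fun T : ℝ => C * Real.exp (-δ * T) * |c - 0|) atTop (𝓝 0) := by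
    have h1 : Tendsto (fun T : ℝ => Real.exp (-δ * T)) atTop (𝓝 0) :=
      Real.tendsto_exp_atBot.comp (tendsto_id.const_mul_atTop_of_neg (neg_lt_zero.2 hδ))
    simpa using (h1.const_mul C).mul_const |c - 0|
  refine squeeze_zero_norm' ?_ hlim
  filter_upwards [eventually_ge_atTop Y, eventually_ge_atTop 0] with T hT hT0
  refine intervalIntegral.norm_integral_le_of_norm_le_const fun x hx' => ?_
  have habs : |η * T| = T := by rw [abs_mul, hη, one_mul, abs_of_nonneg hT0]
  have := h (x + (η * T : ℝ) * Complex.I)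
    (by simpa using hx (uIoc_subset_uIcc hx'))
    (by rw [Complex.add_im, Complex.ofReal_im, Complex.im_ofReal_mul, Complex.I_im, mul_one,
      zero_add, habs]; exact hT)
  rwa [Complex.add_im, Complex.ofReal_im, Complex.im_ofReal_mul, Complex.I_im, mul_one,
      zero_add, habs] at this

/-- The path of integration may be replaced by a vertical line. -/
theorem integral_path_eq_integral_line {γ : ℝ → ℂ} {c x₀ x₁ : ℝ} {f : ℂ → ℂ}
    (hint : Integrable fun t => f (γ t) * deriv γ t) (hd : VerticalDecay x₀ x₁ f)
    (hx : uIcc 0 c ⊆ Icc x₀ x₁) (hf : ∀ t : ℝ, ContinuousAt f (c - t * Complex.I))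
    (hdev : ∀ᶠ T in atTop, deviation γ c T f = 0) :
    ∫ t, f (γ t) * deriv γ t = ∫ t : ℝ, f (c - t * Complex.I) * -Complex.I := by
  have h1 := intervalIntegral_tendsto_integral hint tendsto_neg_atTop_atBot tendsto_id
  have h2 := intervalIntegral_tendsto_integral
    ((hd.integrable_line (hx right_mem_uIcc) hf).mul_const (-Complex.I))
    tendsto_neg_atTop_atBot tendsto_id
  -- The horizontal sides of the rectangle disappear in the limit; the vertical side fills the line.
  have h3 := hd.tendsto_integral_horizontal hx (η := 1) (by simp)
  have h4 := hd.tendsto_integral_horizontal hx (η := -1) (by simp)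
  have h5 := (h3.add h2).sub h4
  rw [zero_add, sub_zero] at h5
  refine tendsto_nhds_unique (h1.congr' ?_) h5
  filter_upwards [hdev] with T hT
  rw [deviation, sub_eq_zero, rectIntegral, intervalIntegral.integral_symm 0 c] at hT
  simp only [id]
  rw [hT]
  push_cast
  simp only [one_mul, neg_mul, ← sub_eq_add_neg]

/-! ### The integrand with a polynomial factor -/

section barnesFun

variable {n : ℕ}

/-- The function `P(s) ∏ₖ Γ(aₖ + s) Γ(bₖ - s) · e^{(2j - n) π i s} e^{s ζ}`. -/
noncomputable def barnesFun (a b : Fin n → ℂ) (j : Fin n) (P : Polynomial ℂ) (ζ s : ℂ) : ℂ :=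
  P.eval s * ((∏ k, Complex.Gamma (a k + s) * Complex.Gamma (b k - s)) *
    Complex.exp ((2 * (j : ℕ) - n) * Real.pi * Complex.I * s) * Complex.exp (s * ζ))

/-- The point `s` is not a pole of `∏ₖ Γ(aₖ + s) Γ(bₖ - s)`. -/
def IsRegular (a b : Fin n → ℂ) (s : ℂ) : Prop :=
  ∀ (k : Fin n) (m : ℕ), s ≠ -a k - m ∧ s ≠ b k + m

/-- A compact subset of the strip `0 < Im ζ < 2π`. -/
def logBox (ρ ε : ℝ) : Set ℂ := Icc (-ρ) ρ ×ℂ Icc ε (2 * Real.pi - ε)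

variable {a b : Fin n → ℂ} {j : Fin n} {P : Polynomial ℂ}

theorem exists_mem_logBox {ζ : ℂ} (h0 : 0 < ζ.im) (h1 : ζ.im < 2 * Real.pi) :
    ∃ ρ ε : ℝ, 0 < ε ∧ ζ ∈ interior (logBox ρ ε) := by
  refine ⟨|ζ.re| + 1, min ζ.im (2 * Real.pi - ζ.im) / 2, by
    have : 0 < min ζ.im (2 * Real.pi - ζ.im) := lt_min h0 (by linarith)
    positivity, ?_⟩
  rw [logBox, Complex.interior_reProdIm, interior_Icc, interior_Icc]
  have h2 := min_le_left ζ.im (2 * Real.pi - ζ.im)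
  have h3 := min_le_right ζ.im (2 * Real.pi - ζ.im)
  exact ⟨⟨by linarith [neg_abs_le ζ.re], by linarith [le_abs_self ζ.re]⟩,
    ⟨by linarith, by linarith⟩⟩

theorem differentiableAt_prod_Gamma {s : ℂ} (hs : IsRegular a b s) :
    DifferentiableAt ℂ
      (fun s => ∏ k, Complex.Gamma (a k + s) * Complex.Gamma (b k - s)) s := by
  refine DifferentiableAt.fun_finsetProd fun k _ => DifferentiableAt.fun_mul ?_ ?_
  · exact (Complex.differentiableAt_Gamma _ fun m h => (hs k m).1 (by linear_combination h)).comp s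
      (by fun_prop)
  · exact (Complex.differentiableAt_Gamma _ fun m h => (hs k m).2 (by linear_combination -h)).comp s
      (by fun_prop)

theorem differentiableAt_barnesFun (ζ : ℂ) {s : ℂ} (hs : IsRegular a b s) :
    DifferentiableAt ℂ (barnesFun a b j P ζ) s :=
  P.differentiableAt.fun_mul (((differentiableAt_prod_Gamma hs).fun_mul (by fun_prop)).fun_mul
    (by fun_prop))

theorem meromorphicAt_barnesFun (ζ s : ℂ) : MeromorphicAt (barnesFun a b j P ζ) s := by
  have hA : ∀ f : ℂ → ℂ, Differentiable ℂ f → MeromorphicAt f s := fun f hf =>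
    (hf.analyticAt s).meromorphicAt
  refine (hA _ P.differentiable).fun_mul (((MeromorphicAt.fun_prod fun k _ => ?_).fun_mul
    (hA _ (by fun_prop))).fun_mul (hA _ (by fun_prop)))
  refine MeromorphicAt.fun_mul ?_ ?_
  · exact (Meromorphic.Gamma (a k + s)).comp_analyticAt (g := fun s => a k + s)
      (Differentiable.analyticAt (by fun_prop) s)
  · exact (Meromorphic.Gamma (b k - s)).comp_analyticAt (g := fun s => b k - s)
      (Differentiable.analyticAt (by fun_prop) s)

/-- Exponential decay of the integrand, locally uniform in the logarithm of `z`. -/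
theorem exists_norm_barnesFun_le (a b : Fin n → ℂ) (j : Fin n) (P : Polynomial ℂ) (x₀ x₁ ρ : ℝ)
    {ε : ℝ} (hε : 0 < ε) : ∃ C δ Y : ℝ, 0 < δ ∧ ∀ ζ ∈ logBox ρ ε, ∀ s : ℂ, s.re ∈ Icc x₀ x₁ →
      Y ≤ |s.im| → ‖barnesFun a b j P ζ s‖ ≤ C * Real.exp (-δ * |s.im|) := by
  have hb : StripBound x₀ x₁ (0 + (Finset.univ : Finset (Fin n)).card * Real.pi) _ :=
    (StripBound.polynomial P).mul (StripBound.prod Finset.univ fun k _ =>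
    StripBound.Gamma_mul_Gamma (a k) (b k))
  obtain ⟨C, N, Y, hC, h⟩ := hb
  rw [Finset.card_fin, zero_add] at h
  set X : ℝ := max |x₀| |x₁| with hX
  -- Half of the decay rate `ε` is spent on absorbing the polynomial growth.
  refine ⟨C * (1 + X) ^ N * (N.factorial * (2 / ε) ^ N * Real.exp (ε / 2)) * Real.exp (X * ρ),
    ε / 2, Y, by positivity, fun ζ hζ s hs hY => ?_⟩
  have hX0 : 0 ≤ X := (abs_nonneg _).trans (le_max_left _ _)
  have hre : |s.re| ≤ X := abs_le_max_abs_abs hs.1 hs.2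
  have h1 := h s hs hY
  have hjn : ((j : ℕ) : ℝ) + 1 ≤ n := by exact_mod_cast j.2
  have hj0 : (0 : ℝ) ≤ (j : ℕ) := Nat.cast_nonneg _
  have e1 : ‖Complex.exp ((2 * (j : ℕ) - n) * Real.pi * Complex.I * s)‖ =
      Real.exp (-((2 * (j : ℕ) - n) * Real.pi * s.im)) := by
    rw [Complex.norm_exp]
    congr 1
    have : (2 * (j : ℕ) - n) * Real.pi * Complex.I * s =
      (((2 * (j : ℕ) - n) * Real.pi : ℝ) : ℂ) * (Complex.I * s) := by push_cast; ring
    rw [this, Complex.re_ofReal_mul, Complex.I_mul_re]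
    ring
  have e2 : ‖Complex.exp (s * ζ)‖ = Real.exp (s.re * ζ.re - s.im * ζ.im) := by
    rw [Complex.norm_exp, Complex.mul_re]
  have h2 : ‖s‖ ≤ X + |s.im| := (Complex.norm_le_abs_re_add_abs_im s).trans (by linarith)
  have h3 : (1 + ‖s‖) ^ N ≤ (1 + X) ^ N * (1 + |s.im|) ^ N := by
    rw [← mul_pow]
    gcongr
    nlinarith [mul_nonneg hX0 (abs_nonneg s.im)]
  have h4 : (1 + |s.im|) ^ N ≤
      N.factorial * (2 / ε) ^ N * Real.exp (ε / 2) * Real.exp (ε / 2 * |s.im|) := by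
    have h5 := Real.pow_div_factorial_le_exp (ε / 2 * (1 + |s.im|)) (by positivity) N
    rw [div_le_iff₀ (by positivity), mul_pow] at h5
    have h6 : (1 + |s.im|) ^ N = (2 / ε) ^ N * ((ε / 2) ^ N * (1 + |s.im|) ^ N) := by
      rw [← mul_assoc, ← mul_pow, show 2 / ε * (ε / 2) = 1 by field_simp, one_pow, one_mul]
    rw [h6]
    calc _ ≤ (2 / ε) ^ N * (Real.exp (ε / 2 * (1 + |s.im|)) * N.factorial) := by gcongr
      _ = _ := by rw [mul_add, mul_one, Real.exp_add]; ring
  -- For `Im s ≥ 0` the total rate is `-2jπ - Im ζ ≤ -ε`; for `Im s < 0` it is `-2(n - j)π + Im ζ ≤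
  -- -ε`, because `j ≤ n - 1`. Both ends of the range of `j` and of the strip enter here.
  have h5 : -(n * Real.pi) * |s.im| + -((2 * (j : ℕ) - n) * Real.pi * s.im) +
      (s.re * ζ.re - s.im * ζ.im) ≤ X * ρ + -ε * |s.im| := by
    have h6 : s.re * ζ.re ≤ X * ρ := by
      refine (le_abs_self _).trans ?_
      rw [abs_mul]
      exact mul_le_mul hre (abs_le.2 hζ.1) (abs_nonneg _) hX0
    have h7 := hζ.2.1
    have h8 := hζ.2.2
    have hπ := Real.pi_pos
    rcases abs_cases s.im with ⟨h, h'⟩ | ⟨h, h'⟩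
    · rw [h]
      nlinarith [mul_nonneg (mul_nonneg hj0 hπ.le) h', mul_le_mul_of_nonneg_right h7 h']
    · rw [h]
      nlinarith [mul_nonneg (mul_nonneg (sub_nonneg.2 hjn) hπ.le) (neg_nonneg.2 h'.le),
        mul_le_mul_of_nonneg_right h8 (neg_nonneg.2 h'.le)]
  have h6 : ‖barnesFun a b j P ζ s‖ =
      ‖P.eval s * ∏ k, Complex.Gamma (a k + s) * Complex.Gamma (b k - s)‖ *
        (Real.exp (-((2 * (j : ℕ) - n) * Real.pi * s.im)) *
          Real.exp (s.re * ζ.re - s.im * ζ.im)) := by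
    rw [barnesFun, norm_mul, norm_mul, norm_mul, norm_mul, e1, e2]
    ring
  rw [h6]
  calc _ ≤ C * (1 + ‖s‖) ^ N * Real.exp (-(n * Real.pi) * |s.im|) *
        (Real.exp (-((2 * (j : ℕ) - n) * Real.pi * s.im)) *
          Real.exp (s.re * ζ.re - s.im * ζ.im)) := by gcongr
    _ = C * (1 + ‖s‖) ^ N * Real.exp (-(n * Real.pi) * |s.im| +
        -((2 * (j : ℕ) - n) * Real.pi * s.im) + (s.re * ζ.re - s.im * ζ.im)) := by
      rw [Real.exp_add, Real.exp_add]; ring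
    _ ≤ C * ((1 + X) ^ N * (N.factorial * (2 / ε) ^ N * Real.exp (ε / 2) *
        Real.exp (ε / 2 * |s.im|))) * Real.exp (X * ρ + -ε * |s.im|) := by
      gcongr
      exact h3.trans (by gcongr)
    _ = C * (1 + X) ^ N * (N.factorial * (2 / ε) ^ N * Real.exp (ε / 2)) * Real.exp (X * ρ) *
        (Real.exp (ε / 2 * |s.im|) * Real.exp (-ε * |s.im|)) := by
      rw [Real.exp_add]; ring
    _ = _ := by
      rw [← Real.exp_add]
      ring_nf

theorem verticalDecay_barnesFun {ζ : ℂ} (h0 : 0 < ζ.im) (h1 : ζ.im < 2 * Real.pi) (x₀ x₁ : ℝ) :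
    VerticalDecay x₀ x₁ (barnesFun a b j P ζ) := by
  obtain ⟨ρ, ε, hε, hζ⟩ := exists_mem_logBox h0 h1
  obtain ⟨C, δ, Y, hδ, h⟩ := exists_norm_barnesFun_le a b j P x₀ x₁ ρ hε
  exact ⟨C, δ, Y, hδ, h ζ (interior_subset hζ)⟩

end barnesFun

/-! ### Dominated integrals and the action of `θ` -/

section

variable {n : ℕ} {a b : Fin n → ℂ} {j : Fin n} {P : Polynomial ℂ} {γ : ℝ → ℂ}

theorem continuous_barnesFun_path (hγ : Continuous γ) (hr : ∀ t, IsRegular a b (γ t)) :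
    Continuous fun p : ℂ × ℝ => barnesFun a b j P p.1 (γ p.2) := by
  have h1 : Continuous fun t =>
      ∏ k, Complex.Gamma (a k + γ t) * Complex.Gamma (b k - γ t) :=
    continuous_iff_continuousAt.2 fun t =>
      ContinuousAt.comp (g := fun s => ∏ k, Complex.Gamma (a k + s) * Complex.Gamma (b k - s))
        (differentiableAt_prod_Gamma (hr t)).continuousAt hγ.continuousAt
  have h2 := h1.comp (continuous_snd (X := ℂ) (Y := ℝ))
  have h3 := (P.continuous.comp hγ).comp (continuous_snd (X := ℂ) (Y := ℝ))
  simp only [Function.comp_def] at h2 h3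
  unfold barnesFun
  fun_prop

/-- The ends of the path lie on the imaginary axis, so the strip bound is needed only for `Re s =
0`; the middle part is bounded by compactness, jointly in `ζ` and `t`. -/
theorem exists_integrable_bound (h : IsImaginaryPath γ) (hr : ∀ t, IsRegular a b (γ t)) (ρ : ℝ)
    {ε : ℝ} (hε : 0 < ε) : ∃ g : ℝ → ℝ, Integrable g ∧ ∀ᵐ t, ∀ ζ ∈ logBox ρ ε,
      ‖barnesFun a b j P ζ (γ t) * deriv γ t‖ ≤ g t := by
  obtain ⟨C, δ, Y, hδ, hC⟩ := exists_norm_barnesFun_le a b j P 0 0 ρ hε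
  obtain ⟨D, hD0, hD⟩ := h.exists_ae_norm_deriv_le
  obtain ⟨T, hT0, hT⟩ := h.exists_pos_ends
  set Y' := max T Y with hY'
  have hY0 : 0 < Y' := hT0.trans_le (le_max_left _ _)
  have hcomp : IsCompact (logBox ρ ε ×ˢ Icc (-Y') Y') :=
    (isCompact_Icc.reProdIm isCompact_Icc).prod isCompact_Icc
  obtain ⟨M, hM⟩ := hcomp.exists_bound_of_continuousOn
    (continuous_barnesFun_path (j := j) (P := P) h.continuous hr).continuousOn
  refine ⟨fun t => max C (M * Real.exp (δ * Y')) * Real.exp (-δ * |t|) * D,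
    ((integrable_exp_neg_mul_abs hδ).const_mul _).mul_const D, ?_⟩
  filter_upwards [hD] with t htD ζ hζ
  rw [norm_mul]
  refine mul_le_mul ?_ htD (norm_nonneg _) ?_
  · by_cases ht : Y' ≤ |t|
    · have e := hT t ((le_max_left _ _).trans ht)
      have him : |(γ t).im| = |t| := by rw [e]; simp
      have := hC ζ hζ (γ t) (by rw [e]; simp) (by rw [him]; exact (le_max_right _ _).trans ht)
      rw [him] at this
      exact this.trans (by gcongr; exact le_max_left _ _)
    · have hlt : |t| ≤ Y' := (not_le.1 ht).le
      have hM1 := hM (ζ, t) ⟨hζ, abs_le.1 hlt⟩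
      have hM0 : 0 ≤ M := (norm_nonneg _).trans hM1
      calc _ ≤ M := hM1
        _ = M * Real.exp (δ * Y') * Real.exp (-δ * Y') := by
          rw [mul_assoc, ← Real.exp_add]; simp
        _ ≤ M * Real.exp (δ * Y') * Real.exp (-δ * |t|) := by
          gcongr M * Real.exp (δ * Y') * Real.exp ?_
          nlinarith
        _ ≤ _ := by gcongr; exact le_max_right _ _
  · have : 0 ≤ max C (M * Real.exp (δ * Y')) := by
      refine le_max_of_le_right ?_
      have hM0 : 0 ≤ M := (norm_nonneg _).trans (hM (ζ, 0) ⟨hζ, by simp [hY0.le]⟩)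
      positivity
    positivity

theorem aestronglyMeasurable_barnesFun (h : IsImaginaryPath γ) (hr : ∀ t, IsRegular a b (γ t))
    (ζ : ℂ) : AEStronglyMeasurable (fun t => barnesFun a b j P ζ (γ t) * deriv γ t) volume :=
  ((continuous_barnesFun_path h.continuous hr).comp
    (Continuous.prodMk_right ζ)).aestronglyMeasurable.mul
    (measurable_deriv γ).aestronglyMeasurable

theorem integrable_barnesFun (h : IsImaginaryPath γ) (hr : ∀ t, IsRegular a b (γ t)) {ζ : ℂ}
    (h0 : 0 < ζ.im) (h1 : ζ.im < 2 * Real.pi) :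
    Integrable fun t => barnesFun a b j P ζ (γ t) * deriv γ t := by
  obtain ⟨ρ, ε, hε, hζ⟩ := exists_mem_logBox h0 h1
  obtain ⟨g, hg, hle⟩ := exists_integrable_bound (j := j) (P := P) h hr ρ hε
  refine hg.mono' (aestronglyMeasurable_barnesFun h hr ζ) ?_
  filter_upwards [hle] with t ht
  exact ht ζ (interior_subset hζ)

theorem barnesFun_X_mul (ζ s : ℂ) :
    barnesFun a b j (Polynomial.X * P) ζ s = s * barnesFun a b j P ζ s := by
  simp only [barnesFun, Polynomial.eval_mul, Polynomial.eval_X]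
  ring

theorem barnesFun_add (Q : Polynomial ℂ) (ζ s : ℂ) :
    barnesFun a b j (P + Q) ζ s = barnesFun a b j P ζ s + barnesFun a b j Q ζ s := by
  simp only [barnesFun, Polynomial.eval_add]
  ring

theorem barnesFun_C_mul (c ζ s : ℂ) :
    barnesFun a b j (Polynomial.C c * P) ζ s = c * barnesFun a b j P ζ s := by
  simp only [barnesFun, Polynomial.eval_mul, Polynomial.eval_C]
  ring

theorem hasDerivAt_integral_barnesFun (h : IsImaginaryPath γ) (hr : ∀ t, IsRegular a b (γ t))
    {ζ : ℂ} (h0 : 0 < ζ.im) (h1 : ζ.im < 2 * Real.pi) :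
    HasDerivAt (fun ζ => ∫ t, barnesFun a b j P ζ (γ t) * deriv γ t)
      (∫ t, barnesFun a b j (Polynomial.X * P) ζ (γ t) * deriv γ t) ζ := by
  obtain ⟨ρ, ε, hε, hζ⟩ := exists_mem_logBox h0 h1
  obtain ⟨g, hg, hle⟩ := exists_integrable_bound (j := j) (P := Polynomial.X * P) h hr ρ hε
  have hdiff : ∀ (t : ℝ) (w : ℂ), HasDerivAt (fun ζ => barnesFun a b j P ζ (γ t) * deriv γ t)
      (barnesFun a b j (Polynomial.X * P) w (γ t) * deriv γ t) w := by
    intro t w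
    have h2 : HasDerivAt (fun w => Complex.exp (γ t * w)) (Complex.exp (γ t * w) * (γ t * 1)) w :=
      ((hasDerivAt_id w).const_mul (γ t)).cexp
    refine (((h2.const_mul _).const_mul (P.eval (γ t))).mul_const (deriv γ t)).congr_deriv ?_
    rw [barnesFun_X_mul, barnesFun]
    ring
  exact (hasDerivAt_integral_of_dominated_loc_of_deriv_le (s := logBox ρ ε)
    (mem_interior_iff_mem_nhds.1 hζ)
    (Eventually.of_forall fun w => aestronglyMeasurable_barnesFun h hr w)
    (integrable_barnesFun h hr h0 h1) (aestronglyMeasurable_barnesFun h hr ζ) hle hg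
    (Eventually.of_forall fun t w _ => hdiff t w)).2

/-- The Mellin–Barnes integral with an additional polynomial factor. -/
noncomputable def barnesInt (a b : Fin n → ℂ) (γ : ℝ → ℂ) (j : Fin n) (P : Polynomial ℂ) (z : ℂ) :
    ℂ :=
  ∫ t, barnesFun a b j P (cutLog z) (γ t) * deriv γ t

theorem hasDerivAt_barnesInt (h : IsImaginaryPath γ) (hr : ∀ t, IsRegular a b (γ t)) {z : ℂ}
    (hz : z ∈ cutPlane) :
    HasDerivAt (barnesInt a b γ j P) (barnesInt a b γ j (Polynomial.X * P) z * z⁻¹) z :=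
  HasDerivAt.comp (h₂ := fun ζ => ∫ t, barnesFun a b j P ζ (γ t) * deriv γ t) z
    (hasDerivAt_integral_barnesFun h hr (cutLog_im hz).1 (cutLog_im hz).2) (hasDerivAt_cutLog hz)

theorem differentiableOn_barnesInt (h : IsImaginaryPath γ) (hr : ∀ t, IsRegular a b (γ t)) :
    DifferentiableOn ℂ (barnesInt a b γ j P) cutPlane := fun _ hz =>
  (hasDerivAt_barnesInt h hr hz).differentiableAt.differentiableWithinAt

theorem barnesInt_add (h : IsImaginaryPath γ) (hr : ∀ t, IsRegular a b (γ t)) {z : ℂ}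
    (hz : z ∈ cutPlane) (Q : Polynomial ℂ) :
    barnesInt a b γ j (P + Q) z = barnesInt a b γ j P z + barnesInt a b γ j Q z := by
  simp only [barnesInt, barnesFun_add, add_mul]
  exact integral_add (integrable_barnesFun h hr (cutLog_im hz).1 (cutLog_im hz).2)
    (integrable_barnesFun h hr (cutLog_im hz).1 (cutLog_im hz).2)

theorem barnesInt_C_mul (c z : ℂ) :
    barnesInt a b γ j (Polynomial.C c * P) z = c * barnesInt a b γ j P z := by
  simp only [barnesInt, barnesFun_C_mul, mul_assoc, integral_const_mul]

theorem foldr_thetaAdd_congr (l : List ℂ) {f g : ℂ → ℂ} (hfg : EqOn f g cutPlane) :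
    EqOn (l.foldr thetaAdd f) (l.foldr thetaAdd g) cutPlane := by
  induction l with
  | nil => exact hfg
  | cons c l ih =>
    intro z hz
    have hev := eventually_of_mem (isOpen_cutPlane.mem_nhds hz) ih
    simp only [List.foldr_cons, thetaAdd]
    rw [EventuallyEq.deriv_eq hev, ih hz]

/-- In the variable `ζ = cutLog z` the operator `θ` is `d/dζ`, which brings down `s` from `e^{sζ}`;
so `θ + c` inserts the factor `s + c`. -/
theorem foldr_thetaAdd_barnesInt (h : IsImaginaryPath γ) (hr : ∀ t, IsRegular a b (γ t))
    (l : List ℂ) {z : ℂ} (hz : z ∈ cutPlane) :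
    l.foldr thetaAdd (barnesInt a b γ j P) z =
      barnesInt a b γ j ((l.map fun c => Polynomial.X + Polynomial.C c).prod * P) z := by
  induction l generalizing z with
  | nil => simp
  | cons c l ih =>
    have hev := eventually_of_mem (isOpen_cutPlane.mem_nhds hz) fun w hw => ih hw
    have hz0 := ne_zero_of_mem_cutPlane hz
    simp only [List.foldr_cons, thetaAdd, List.map_cons, List.prod_cons]
    rw [EventuallyEq.deriv_eq hev, ih hz, (hasDerivAt_barnesInt h hr hz).deriv, mul_assoc,
      add_mul, barnesInt_add h hr hz, barnesInt_C_mul]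
    field_simp

end

/-! ### Translating the path by one -/

section

variable {n : ℕ} {a b : Fin n → ℂ} {j : Fin n} {P : Polynomial ℂ} {γ : ℝ → ℂ}

/-- The poles of `∏ₖ Γ(aₖ + s)` lie to the left of the path, those of `∏ₖ Γ(bₖ - s)` to the
right. -/
structure Separates (γ : ℝ → ℂ) (a b : Fin n → ℂ) : Prop where
  left : ∀ (k : Fin n) (m : ℕ), -a k - m ∈ leftSide γ
  right : ∀ (k : Fin n) (m : ℕ), b k + m ∈ rightSide γ

theorem Separates.isRegular (h : Separates γ a b) (t : ℝ) : IsRegular a b (γ t) := fun k m =>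
  ⟨fun e => notMem_range_of_mem_leftSide (h.left k m) ⟨t, e⟩,
    fun e => notMem_range_of_mem_rightSide (h.right k m) ⟨t, e⟩⟩

/-- Raising the parameters by natural numbers only drops poles. -/
theorem Separates.add_nat (h : Separates γ a b) (K K' : ℕ) :
    Separates γ (fun k => a k + K) fun k => b k + K' where
  left k m := by
    have := h.left k (K + m)
    push_cast at this
    rwa [neg_add, sub_eq_add_neg, add_assoc, ← neg_add, ← sub_eq_add_neg]
  right k m := by
    have := h.right k (K' + m)
    push_cast at this
    rwa [add_assoc]

theorem isRegular_line {c : ℝ} (hc : ∀ k, (-a k).re < c ∧ c < (b k).re) {s : ℂ} (hs : s.re = c) :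
    IsRegular a b s := by
  refine fun k m => ⟨fun e => ?_, fun e => ?_⟩
  · have h1 := (hc k).1
    rw [← hs, e] at h1
    simp only [Complex.sub_re, Complex.natCast_re] at h1
    linarith [(Nat.cast_nonneg m : (0 : ℝ) ≤ m)]
  · have h1 := (hc k).2
    rw [← hs, e] at h1
    simp only [Complex.add_re, Complex.natCast_re] at h1
    linarith [(Nat.cast_nonneg m : (0 : ℝ) ≤ m)]

theorem eventually_deviation_barnesFun_eq_zero (h : IsImaginaryPath γ) (hs : Separates γ a b)
    {c : ℝ} (hc : ∀ k, (-a k).re < c ∧ c < (b k).re) (ζ : ℂ) :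
    ∀ᶠ T in atTop, deviation γ c T (barnesFun a b j P ζ) = 0 := by
  obtain ⟨T₀, -, hT₀⟩ := h.exists_pos_ends
  have h1 : ∀ᶠ T : ℝ in atTop, ∀ k, |(a k).im| < T ∧ |(b k).im| < T :=
    eventually_all.2 fun k => (eventually_gt_atTop _).and (eventually_gt_atTop _)
  filter_upwards [eventually_ge_atTop T₀, h1] with T hTT₀ hT
  obtain ⟨R, hR⟩ := (isCompact_boundarySet (c := c) (T := T) h.continuous).isBounded.subset_ball 0
  -- Poles with index `m ≥ M` lie outside the ball of radius `R`, so finitely many remain.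
  obtain ⟨M, hM⟩ := exists_nat_ge (R + ∑ k, (‖a k‖ + ‖b k‖))
  classical
  set poles : Finset ℂ := (Finset.univ ×ˢ Finset.range M).image (fun q : Fin n × ℕ => -a q.1 - q.2) ∪
    (Finset.univ ×ˢ Finset.range M).image (fun q : Fin n × ℕ => b q.1 + q.2) with hpoles
  refine deviation_eq_zero h (fun t ht => hT₀ t (hTT₀.trans ht)) hR poles ?_ ?_
    fun p _ => meromorphicAt_barnesFun ζ p
  · intro p hp
    simp only [hpoles, Finset.mem_union, Finset.mem_image, Finset.mem_product, Finset.mem_univ,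
      true_and, Prod.exists] at hp
    rcases hp with ⟨k, m, -, rfl⟩ | ⟨k, m, -, rfl⟩
    · refine ⟨Or.inl ⟨hs.left k m, ?_⟩, by simpa using (hT k).1⟩
      have := (hc k).1
      simp only [Complex.sub_re, Complex.natCast_re]
      linarith [(Nat.cast_nonneg m : (0 : ℝ) ≤ m)]
    · refine ⟨Or.inr ⟨hs.right k m, ?_⟩, by simpa using (hT k).2⟩
      have := (hc k).2
      simp only [Complex.add_re, Complex.natCast_re]
      linarith [(Nat.cast_nonneg m : (0 : ℝ) ≤ m)]
  · intro s hsR hsp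
    refine differentiableAt_barnesFun ζ fun k m => ?_
    rw [mem_ball_zero_iff] at hsR
    have hk : ‖a k‖ + ‖b k‖ ≤ ∑ k, (‖a k‖ + ‖b k‖) :=
      Finset.single_le_sum (f := fun k => ‖a k‖ + ‖b k‖) (fun _ _ => by positivity)
        (Finset.mem_univ k)
    have ha := norm_nonneg (a k)
    have hb := norm_nonneg (b k)
    have hbig : ∀ w : ℂ, ‖w‖ ≤ ‖a k‖ + ‖b k‖ → ‖w + m‖ < R → m < M := by
      intro w hw hlt
      have := norm_sub_le (w + m) w
      rw [add_sub_cancel_left, Complex.norm_natCast] at this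
      have : (m : ℝ) < M := by linarith
      exact_mod_cast this
    refine ⟨fun e => hsp ?_, fun e => hsp ?_⟩
    · simp only [hpoles, Finset.mem_union, Finset.mem_image, Finset.mem_product, Finset.mem_univ,
        true_and, Prod.exists, Finset.mem_range]
      refine Or.inl ⟨k, m, hbig (a k) (by linarith) ?_, e.symm⟩
      rwa [e, ← norm_neg, show -(-a k - (m : ℂ)) = a k + m by ring] at hsR
    · simp only [hpoles, Finset.mem_union, Finset.mem_image, Finset.mem_product, Finset.mem_univ,
        true_and, Prod.exists, Finset.mem_range]
      refine Or.inr ⟨k, m, hbig (b k) (by linarith) ?_, e.symm⟩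
      rwa [e] at hsR

theorem integral_barnesFun_eq_integral_line (h : IsImaginaryPath γ) (hs : Separates γ a b)
    {c : ℝ} (hc : ∀ k, (-a k).re < c ∧ c < (b k).re) {ζ : ℂ} (h0 : 0 < ζ.im)
    (h1 : ζ.im < 2 * Real.pi) :
    ∫ t, barnesFun a b j P ζ (γ t) * deriv γ t =
      ∫ t : ℝ, barnesFun a b j P ζ (c - t * Complex.I) * -Complex.I :=
  integral_path_eq_integral_line (integrable_barnesFun h hs.isRegular h0 h1)
    (verticalDecay_barnesFun h0 h1 _ _) Subset.rfl
    (fun _ => (differentiableAt_barnesFun ζ (isRegular_line hc (by simp))).continuousAt)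
    (eventually_deviation_barnesFun_eq_zero h hs hc ζ)

/-- The polynomial that moves the parameters of the gamma factors by `K` and `K'`. -/
noncomputable def shiftPoly (a b : Fin n → ℂ) (K K' : ℕ) : Polynomial ℂ :=
  ∏ k, (∏ m ∈ Finset.range K, (Polynomial.X + Polynomial.C (a k + m))) *
    ∏ m ∈ Finset.range K', (Polynomial.C (b k + m) - Polynomial.X)

theorem barnesFun_shiftPoly_mul (K K' : ℕ) (ζ : ℂ) {s : ℂ} (hs : IsRegular a b s) :
    barnesFun a b j (shiftPoly a b K K' * P) ζ s =
      barnesFun (fun k => a k + K) (fun k => b k + K') j P ζ s := by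
  have h1 : ∀ k, Complex.Gamma (a k + K + s) * Complex.Gamma (b k + K' - s) =
      ((∏ m ∈ Finset.range K, (s + (a k + m))) * ∏ m ∈ Finset.range K', (b k + m - s)) *
        (Complex.Gamma (a k + s) * Complex.Gamma (b k - s)) := by
    intro k
    rw [show a k + K + s = a k + s + K by ring, show b k + K' - s = b k - s + K' by ring,
      Gamma_add_nat_eq_prod K fun m e => (hs k m).1 (by linear_combination e),
      Gamma_add_nat_eq_prod K' fun m e => (hs k m).2 (by linear_combination -e)]
    have e1 : ∀ m : ℕ, s + (a k + m) = a k + s + m := fun m => by ring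
    have e2 : ∀ m : ℕ, b k + m - s = b k - s + m := fun m => by ring
    simp only [e1, e2]
    ring
  simp only [barnesFun, h1, Finset.prod_mul_distrib, shiftPoly, Polynomial.eval_mul,
    Polynomial.eval_prod, Polynomial.eval_add, Polynomial.eval_sub, Polynomial.eval_X,
    Polynomial.eval_C]
  ring

/-- Translation by 1 turns a raised `b` into a raised `a`. For `ζ = cutLog z` the scalar in front is
`(-1)^n z`, which yields the factor `z` of the equation. -/
theorem barnesFun_add_one (ζ s : ℂ) :
    barnesFun a (fun k => b k + 1) j P ζ (s + 1) =
      Complex.exp ((2 * (j : ℕ) - n) * Real.pi * Complex.I) * Complex.exp ζ *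
        barnesFun (fun k => a k + 1) b j (P.comp (Polynomial.X + 1)) ζ s := by
  simp only [barnesFun, Polynomial.eval_comp, Polynomial.eval_add, Polynomial.eval_X,
    Polynomial.eval_one, mul_add, add_mul, mul_one, one_mul, Complex.exp_add]
  have e1 : ∀ k, a k + (s + 1) = a k + 1 + s := fun k => by ring
  have e2 : ∀ k, b k + 1 - (s + 1) = b k - s := fun k => by ring
  simp only [e1, e2]
  ring

theorem IsRegular.add_one {s : ℂ} (h : IsRegular (fun k => a k + 1) b s) :
    IsRegular a (fun k => b k + 1) (s + 1) := fun k m =>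
  ⟨fun e => (h k m).1 (by linear_combination e), fun e => (h k m).2 (by linear_combination e)⟩

/-- The integrals along `γ` and `γ + 1` agree after multiplication with a polynomial that cancels
the poles on the wrong side of some vertical line. -/
theorem integral_barnesFun_add_one_of_shiftPoly (h : IsImaginaryPath γ) (hs : Separates γ a b)
    {K K' : ℕ} {c : ℝ} (hc : ∀ k, (-a k).re < c + K ∧ c < (b k).re + K') {ζ : ℂ} (h0 : 0 < ζ.im)
    (h1 : ζ.im < 2 * Real.pi) :
    ∫ t, barnesFun a (fun k => b k + 1) j (shiftPoly a (fun k => b k + 1) K K' * P) ζ (γ t + 1) *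
        deriv γ t =
      ∫ t, barnesFun a (fun k => b k + 1) j (shiftPoly a (fun k => b k + 1) K K' * P) ζ (γ t) *
        deriv γ t := by
  have hs1 : Separates γ a (fun k => b k + 1) := by simpa using hs.add_nat 0 1
  have hs2 : Separates γ (fun k => a k + 1) b := by simpa using hs.add_nat 1 0
  have hs3 := hs1.add_nat K K'
  have hs4 : Separates γ (fun k => a k + K + 1) (fun k => b k + K') := by
    simpa [add_assoc] using hs.add_nat (K + 1) K'
  have hb : (fun k => b k + 1 + (K' : ℂ)) = fun k => b k + K' + 1 := by
    funext k
    ring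
  have e1 : ∀ t, barnesFun a (fun k => b k + 1) j (shiftPoly a (fun k => b k + 1) K K' * P) ζ
      (γ t + 1) = Complex.exp ((2 * (j : ℕ) - n) * Real.pi * Complex.I) * Complex.exp ζ *
        barnesFun (fun k => a k + K + 1) (fun k => b k + K') j (P.comp (Polynomial.X + 1)) ζ
        (γ t) := fun t => by
    rw [barnesFun_shiftPoly_mul K K' ζ (hs2.isRegular t).add_one, hb, barnesFun_add_one]
  have e2 : ∀ t, barnesFun a (fun k => b k + 1) j (shiftPoly a (fun k => b k + 1) K K' * P) ζ
      (γ t) = barnesFun (fun k => a k + K) (fun k => b k + 1 + K') j P ζ (γ t) := fun t =>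
    barnesFun_shiftPoly_mul K K' ζ (hs1.isRegular t)
  simp only [e1, e2]
  simp only [mul_assoc, integral_const_mul]
  -- The translated integrand goes to the line `Re s = c`, the other one to `Re s = c + 1`; these
  -- two line integrals correspond point by point.
  rw [integral_barnesFun_eq_integral_line h hs4 (c := c) (fun k => ?_) h0 h1,
    integral_barnesFun_eq_integral_line h hs3 (c := c + 1) (fun k => ?_) h0 h1,
    ← integral_const_mul, ← integral_const_mul]
  · congr 1
    funext t
    rw [hb, show ((c + 1 : ℝ) : ℂ) - t * Complex.I = c - t * Complex.I + 1 by push_cast; ring,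
      barnesFun_add_one]
    simp only [mul_assoc]
  · have := hc k
    simp only [Complex.neg_re, Complex.add_re, Complex.natCast_re, Complex.one_re] at this ⊢
    constructor <;> linarith
  · have := hc k
    simp only [Complex.neg_re, Complex.add_re, Complex.natCast_re, Complex.one_re] at this ⊢
    constructor <;> linarith

/-- For linear factors, `(X + u) + (v - X) = u + v` is a nonzero constant, since no `a k + b l` is
an integer. This is where non-resonance is used. -/
theorem isCoprime_shiftPoly (hab : ∀ (k l : Fin n) (m : ℤ), a k + b l ≠ m) (K K' : ℕ) :
    IsCoprime (shiftPoly a b K 0) (shiftPoly a b 0 K') := by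
  simp only [shiftPoly, Finset.range_zero, Finset.prod_empty, mul_one, one_mul]
  refine IsCoprime.prod_left fun k _ => IsCoprime.prod_left fun m _ =>
    IsCoprime.prod_right fun l _ => IsCoprime.prod_right fun m' _ => ?_
  have h : a k + m + (b l + m') ≠ 0 := fun e => hab k l (-(m + m')) (by
    push_cast
    linear_combination e)
  refine ⟨Polynomial.C (a k + m + (b l + m'))⁻¹, Polynomial.C (a k + m + (b l + m'))⁻¹, ?_⟩
  rw [← mul_add, show ∀ u v : ℂ, Polynomial.X + Polynomial.C u + (Polynomial.C v - Polynomial.X) =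
    Polynomial.C (u + v) from fun u v => by rw [Polynomial.C_add]; ring, ← Polynomial.C_mul,
    inv_mul_cancel₀ h, Polynomial.C_1]

/-- Write `1 = x p + y q`, where `p` cancels left poles and `q` right poles. For each summand a
separating line exists. -/
theorem integral_barnesFun_add_one (h : IsImaginaryPath γ) (hs : Separates γ a b)
    (hab : ∀ (k l : Fin n) (m : ℤ), a k + b l ≠ m) {ζ : ℂ} (h0 : 0 < ζ.im)
    (h1 : ζ.im < 2 * Real.pi) :
    ∫ t, barnesFun a (fun k => b k + 1) j 1 ζ (γ t + 1) * deriv γ t =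
      ∫ t, barnesFun a (fun k => b k + 1) j 1 ζ (γ t) * deriv γ t := by
  have hs1 : Separates γ a (fun k => b k + 1) := by simpa using hs.add_nat 0 1
  have hs2 : Separates γ (fun k => a k + 1) b := by simpa using hs.add_nat 1 0
  set D := ∑ k, (‖a k‖ + ‖b k‖) with hD
  have hk : ∀ k, |(a k).re| + |(b k).re| ≤ D := fun k =>
    (add_le_add (Complex.abs_re_le_norm _) (Complex.abs_re_le_norm _)).trans
      (Finset.single_le_sum (f := fun k => ‖a k‖ + ‖b k‖) (fun _ _ => by positivity)
        (Finset.mem_univ k))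
  -- All parameters have real part at most `D` in absolute value. The lines `Re s = ∓(D + 1)` pass
  -- beyond one family, and a shift by more than `2(D + 1)` carries the other family across.
  obtain ⟨K, hK⟩ := exists_nat_gt (2 * (D + 1))
  obtain ⟨x, y, hxy⟩ := isCoprime_shiftPoly (a := a) (b := fun k => b k + 1)
    (fun k l m e => hab k l (m - 1) (by push_cast; linear_combination e)) K K
  have hx := integral_barnesFun_add_one_of_shiftPoly (j := j) (P := x) (K := K) (K' := 0)
    (c := -(D + 1)) h hs (fun k => by
      have h2 := hk k
      have h3 := abs_nonneg (a k).re
      have h4 := abs_nonneg (b k).re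
      have h5 := neg_abs_le (a k).re
      have h6 := neg_abs_le (b k).re
      simp only [Complex.neg_re, Nat.cast_zero]
      constructor <;> linarith) h0 h1
  have hy := integral_barnesFun_add_one_of_shiftPoly (j := j) (P := y) (K := 0) (K' := K)
    (c := D + 1) h hs (fun k => by
      have h2 := hk k
      have h3 := abs_nonneg (a k).re
      have h4 := abs_nonneg (b k).re
      have h5 := neg_abs_le (a k).re
      have h6 := neg_abs_le (b k).re
      simp only [Complex.neg_re, Nat.cast_zero]
      constructor <;> linarith) h0 h1
  rw [mul_comm x, mul_comm y] at hxy
  have hint : ∀ P : Polynomial ℂ, Integrable fun t =>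
      barnesFun a (fun k => b k + 1) j P ζ (γ t + 1) * deriv γ t := fun P => by
    simp only [barnesFun_add_one, mul_assoc]
    exact ((integrable_barnesFun h hs2.isRegular h0 h1).const_mul _).const_mul _
  rw [← hxy]
  simp only [barnesFun_add, add_mul]
  rw [integral_add (hint _) (hint _), integral_add (integrable_barnesFun h hs1.isRegular h0 h1)
    (integrable_barnesFun h hs1.isRegular h0 h1), hx, hy]

end

/-! ### The differential equation and linear independence -/

section

variable {n : ℕ} {a b : Fin n → ℂ} {γ : ℝ → ℂ}

theorem exp_two_mul_sub_mul_pi_mul_I (j n : ℕ) :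
    Complex.exp ((2 * j - n) * Real.pi * Complex.I) = (-1) ^ n := by
  have h : (2 * j - n) * Real.pi * Complex.I =
      j * (2 * Real.pi * Complex.I) - n * (Real.pi * Complex.I) := by ring
  rw [h, Complex.exp_sub, Complex.exp_nat_mul, Complex.exp_nat_mul, Complex.exp_two_pi_mul_I,
    Complex.exp_pi_mul_I, one_pow, one_div, ← inv_pow, inv_neg_one]

/-- The Mellin–Barnes integral solves the hypergeometric equation. -/
theorem mul_barnesInt_eq_barnesInt (h : IsImaginaryPath γ) (hs : Separates γ a b)
    (hab : ∀ (k l : Fin n) (m : ℤ), a k + b l ≠ m) (j : Fin n) {z : ℂ} (hz : z ∈ cutPlane) :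
    z * barnesInt a b γ j (∏ k, (Polynomial.X + Polynomial.C (a k))) z =
      barnesInt a b γ j (∏ k, (Polynomial.X + Polynomial.C (-b k))) z := by
  have hshift := integral_barnesFun_add_one (j := j) h hs hab (cutLog_im hz).1 (cutLog_im hz).2
  have e1 : (∏ k, (Polynomial.X + Polynomial.C (a k))) = shiftPoly a b 1 0 * 1 := by
    simp [shiftPoly]
  have e2 : (∏ k, (Polynomial.X + Polynomial.C (-b k))) =
      Polynomial.C ((-1) ^ n) * (shiftPoly a b 0 1 * 1) := by
    have : ∀ k, Polynomial.X + Polynomial.C (-b k) =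
        -1 * (Polynomial.C (b k) - Polynomial.X) := fun k => by rw [Polynomial.C_neg]; ring
    rw [Finset.prod_congr rfl fun k _ => this k, Finset.prod_mul_distrib]
    simp [shiftPoly]
  -- The two sides are `(-1)^n` times one function, with all `b` raised by 1, evaluated on `γ` and
  -- on `γ + 1`.
  have h1 : ∀ t, barnesFun a b j (∏ k, (Polynomial.X + Polynomial.C (-b k))) (cutLog z) (γ t) =
      (-1) ^ n * barnesFun a (fun k => b k + 1) j 1 (cutLog z) (γ t) := fun t => by
    rw [e2, barnesFun_C_mul, barnesFun_shiftPoly_mul 0 1 _ (hs.isRegular t)]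
    simp
  have h2 : ∀ t, z * barnesFun a b j (∏ k, (Polynomial.X + Polynomial.C (a k))) (cutLog z) (γ t) =
      (-1) ^ n * barnesFun a (fun k => b k + 1) j 1 (cutLog z) (γ t + 1) := fun t => by
    rw [e1, barnesFun_shiftPoly_mul 1 0 _ (hs.isRegular t), barnesFun_add_one,
      exp_cutLog (ne_zero_of_mem_cutPlane hz), exp_two_mul_sub_mul_pi_mul_I, ← mul_assoc,
      ← mul_assoc, ← mul_pow]
    simp
  simp only [barnesInt]
  rw [← integral_const_mul]
  simp only [← mul_assoc, h1, h2]
  simp only [mul_assoc, integral_const_mul, hshift]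

/-- Applying `θ` to a relation inserts a factor `s`, so a linear relation holds with every
polynomial factor. -/
theorem sum_barnesInt_eq_zero (h : IsImaginaryPath γ) (hs : Separates γ a b) {c : Fin n → ℂ}
    (hc : ∀ z ∈ cutPlane, ∑ j, c j * barnesInt a b γ j 1 z = 0) (P : Polynomial ℂ) {z : ℂ}
    (hz : z ∈ cutPlane) : ∑ j, c j * barnesInt a b γ j P z = 0 := by
  have hX : ∀ Q : Polynomial ℂ, (∀ z ∈ cutPlane, ∑ j, c j * barnesInt a b γ j Q z = 0) →
      ∀ z ∈ cutPlane, ∑ j, c j * barnesInt a b γ j (Polynomial.X * Q) z = 0 := by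
    intro Q hQ z hz
    have hd : HasDerivAt (fun z => ∑ j, c j * barnesInt a b γ j Q z)
        (∑ j, c j * (barnesInt a b γ j (Polynomial.X * Q) z * z⁻¹)) z :=
      HasDerivAt.fun_sum fun j _ => (hasDerivAt_barnesInt h hs.isRegular hz).const_mul (c j)
    have h0 : HasDerivAt (fun z => ∑ j, c j * barnesInt a b γ j Q z) 0 z :=
      (hasDerivAt_const z (0 : ℂ)).congr_of_eventuallyEq
        (eventually_of_mem (isOpen_cutPlane.mem_nhds hz) hQ)
    have := hd.unique h0
    simp only [← mul_assoc, ← Finset.sum_mul] at this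
    exact (mul_eq_zero.1 this).resolve_right (inv_ne_zero (ne_zero_of_mem_cutPlane hz))
  have hC : ∀ (Q : Polynomial ℂ) (x : ℂ), (∀ z ∈ cutPlane, ∑ j, c j * barnesInt a b γ j Q z = 0) →
      ∀ z ∈ cutPlane, ∑ j, c j * barnesInt a b γ j (Polynomial.C x * Q) z = 0 := by
    intro Q x hQ z hz
    simp only [barnesInt_C_mul, mul_left_comm _ x, ← Finset.mul_sum, hQ z hz, mul_zero]
  suffices ∀ z ∈ cutPlane, ∑ j, c j * barnesInt a b γ j P z = 0 from this z hz
  induction P using Polynomial.induction_on' with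
  | add p q hp hq =>
    intro z hz
    simp only [barnesInt_add h hs.isRegular hz, mul_add, Finset.sum_add_distrib, hp z hz, hq z hz,
      add_zero]
  | monomial m x =>
    have hpow : ∀ z ∈ cutPlane, ∑ j, c j * barnesInt a b γ j (Polynomial.X ^ m) z = 0 := by
      induction m with
      | zero => simpa using hc
      | succ m ih =>
        rw [pow_succ']
        exact hX _ ih
    rw [← Polynomial.C_mul_X_pow_eq_monomial]
    exact hC _ x hpow

theorem prod_Gamma_ne_zero {s : ℂ} (hs : IsRegular a b s) :
    ∏ k, Complex.Gamma (a k + s) * Complex.Gamma (b k - s) ≠ 0 :=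
  Finset.prod_ne_zero_iff.2 fun k _ => mul_ne_zero
    (Complex.Gamma_ne_zero fun m e => (hs k m).1 (by linear_combination e))
    (Complex.Gamma_ne_zero fun m e => (hs k m).2 (by linear_combination -e))

/-- A continuous integrable function with vanishing Fourier transform is zero. -/
theorem eq_zero_of_integral_mul_exp_eq_zero {φ : ℝ → ℂ} (hc : Continuous φ) (hi : Integrable φ)
    (h : ∀ u : ℝ, ∫ t, φ t * Complex.exp (-(t * u * Complex.I)) = 0) (t : ℝ) : φ t = 0 := by
  have h0 : FourierTransform.fourier φ = 0 := by
    funext w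
    rw [Real.fourier_real_eq_integral_exp_smul, Pi.zero_apply, ← h (2 * Real.pi * w)]
    congr 1
    funext t
    rw [smul_eq_mul, mul_comm]
    congr 2
    push_cast
    ring
  have h1 := hc.fourierInv_fourier_eq hi (by rw [h0]; exact integrable_zero _ _ _)
  rw [← h1, h0, Real.fourierInv_eq']
  simp

/-- The Mellin–Barnes integrals are linearly independent. -/
theorem eq_zero_of_sum_barnesInt_eq_zero (h : IsImaginaryPath γ) (hs : Separates γ a b)
    {c : Fin n → ℂ} (hc : ∀ z ∈ cutPlane, ∑ j, c j * barnesInt a b γ j 1 z = 0) : c = 0 := by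
  set D := ∑ k, (‖a k‖ + ‖b k‖) with hD
  have hk : ∀ k, |(a k).re| + |(b k).re| ≤ D := fun k =>
    (add_le_add (Complex.abs_re_le_norm _) (Complex.abs_re_le_norm _)).trans
      (Finset.single_le_sum (f := fun k => ‖a k‖ + ‖b k‖) (fun _ _ => by positivity)
        (Finset.mem_univ k))
  obtain ⟨K, hK⟩ := exists_nat_gt (2 * (D + 1))
  set x : ℝ := -(D + 1) with hx
  have hsep : ∀ k, (-(a k + K)).re < x ∧ x < (b k + (0 : ℕ)).re := fun k => by
    have h2 := hk k
    have h3 := abs_nonneg (a k).re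
    have h4 := abs_nonneg (b k).re
    have h5 := neg_abs_le (a k).re
    have h6 := neg_abs_le (b k).re
    simp only [Complex.neg_re, Complex.add_re, Complex.natCast_re, Nat.cast_zero, Complex.zero_re]
    constructor <;> linarith
  have hs' := hs.add_nat K 0
  have hreg : ∀ t : ℝ, IsRegular (fun k => a k + K) (fun k => b k + (0 : ℕ))
      (x - t * Complex.I) := fun t => isRegular_line hsep (by simp)
  have hπ0 : 0 < (Real.pi * Complex.I).im := by simpa using Real.pi_pos
  have hπ1 : (Real.pi * Complex.I).im < 2 * Real.pi := by simpa using by linarith [Real.pi_pos]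
  set φ : ℝ → ℂ := fun t => ∑ j, c j * barnesFun (fun k => a k + K) (fun k => b k + (0 : ℕ)) j 1
    (Real.pi * Complex.I) (x - t * Complex.I) with hφ
  have hcont : ∀ (j : Fin n) (t : ℝ), ContinuousAt (barnesFun (fun k => a k + K)
      (fun k => b k + (0 : ℕ)) j 1 (Real.pi * Complex.I)) (x - t * Complex.I) := fun j t =>
    (differentiableAt_barnesFun _ (hreg t)).continuousAt
  have hφc : Continuous φ := continuous_finsetSum _ fun j _ => continuous_const.mul
    (continuous_iff_continuousAt.2 fun t =>
      ContinuousAt.comp (f := fun t : ℝ => (x - t * Complex.I : ℂ)) (hcont j t) (by fun_prop))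
  have hφi : Integrable φ := integrable_finsetSum _ fun j _ =>
    ((verticalDecay_barnesFun hπ0 hπ1 x x).integrable_line ⟨le_rfl, le_rfl⟩ (hcont j)).const_mul _
  have hφ0 : ∀ t, φ t = 0 := by
    refine eq_zero_of_integral_mul_exp_eq_zero hφc hφi fun u => ?_
    set ζ : ℂ := u + Real.pi * Complex.I with hζ
    have hζim : ζ.im = Real.pi := by simp [hζ]
    have hζ0 : 0 < ζ.im := by rw [hζim]; exact Real.pi_pos
    have hζ1 : ζ.im < 2 * Real.pi := by rw [hζim]; linarith [Real.pi_pos]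
    -- The polynomial removes the left poles beyond the line `Re s = x`. For `z = e^{u + πi}` with
    -- `u` real, the relation on that line says that the Fourier transform of `φ` vanishes.
    have h1 := sum_barnesInt_eq_zero h hs hc (shiftPoly a b K 0 * 1) (exp_mem_cutPlane hζ0 hζ1)
    simp only [barnesInt, cutLog_exp hζ0 hζ1, barnesFun_shiftPoly_mul K 0 ζ (hs.isRegular _)] at h1
    simp only [integral_barnesFun_eq_integral_line h hs' hsep hζ0 hζ1, integral_mul_const,
      ← mul_assoc, ← Finset.sum_mul] at h1
    have h2 := (mul_eq_zero.1 h1).resolve_right (neg_ne_zero.2 Complex.I_ne_zero)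
    have h3 : ∀ (j : Fin n) (t : ℝ), barnesFun (fun k => a k + K) (fun k => b k + (0 : ℕ)) j 1
        (Real.pi * Complex.I) (x - t * Complex.I) * Complex.exp (-(t * u * Complex.I)) =
        Complex.exp (-(x * u)) * barnesFun (fun k => a k + K) (fun k => b k + (0 : ℕ)) j 1 ζ
          (x - t * Complex.I) := by
      intro j t
      have : Complex.exp ((x - t * Complex.I) * ζ) =
          Complex.exp ((x - t * Complex.I) * (Real.pi * Complex.I)) *
            (Complex.exp (-(t * u * Complex.I)) * Complex.exp (x * u)) := by
        rw [← Complex.exp_add, ← Complex.exp_add, hζ]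
        congr 1
        ring
      simp only [barnesFun, this]
      have h4 : Complex.exp (-(x * u)) * Complex.exp (x * u) = 1 := by
        rw [← Complex.exp_add]; simp
      linear_combination (-(Polynomial.eval (x - t * Complex.I : ℂ) 1) *
        (∏ k, Complex.Gamma (a k + K + (x - t * Complex.I)) *
          Complex.Gamma (b k + (0 : ℕ) - (x - t * Complex.I))) *
        Complex.exp ((2 * (j : ℕ) - n) * Real.pi * Complex.I * (x - t * Complex.I)) *
        Complex.exp ((x - t * Complex.I) * (Real.pi * Complex.I)) *
        Complex.exp (-(t * u * Complex.I))) * h4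
    have h5 : ∀ t, φ t * Complex.exp (-(t * u * Complex.I)) = Complex.exp (-(x * u)) *
        ∑ j, c j * barnesFun (fun k => a k + K) (fun k => b k + (0 : ℕ)) j 1 ζ
          (x - t * Complex.I) := by
      intro t
      simp only [hφ, Finset.sum_mul, Finset.mul_sum]
      exact Finset.sum_congr rfl fun j _ => by rw [mul_assoc, h3, mul_left_comm]
    simp only [h5]
    rw [integral_const_mul, integral_finsetSum]
    · simp only [integral_const_mul, h2, mul_zero]
    · exact fun j _ => ((verticalDecay_barnesFun hζ0 hζ1 x x).integrable_line ⟨le_rfl, le_rfl⟩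
        fun t => (differentiableAt_barnesFun _ (hreg t)).continuousAt).const_mul _
  -- On the line, `φ` is `p(e^{2πis})` times a factor without zeros, and `e^{2πis} = e^{2πix}
  -- e^{2πt}` takes infinitely many values.
  set p : Polynomial ℂ := ∑ j : Fin n, Polynomial.C (c j) * Polynomial.X ^ (j : ℕ) with hp
  have hroot : ∀ t : ℝ, p.IsRoot
      (Complex.exp (2 * Real.pi * Complex.I * x) * (Real.exp (2 * Real.pi * t) : ℝ)) := by
    intro t
    have h1 := hφ0 t
    have h2 : ∀ j : Fin n, barnesFun (fun k => a k + K) (fun k => b k + (0 : ℕ)) j 1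
        (Real.pi * Complex.I) (x - t * Complex.I) =
        (Complex.exp (2 * Real.pi * Complex.I * x) * (Real.exp (2 * Real.pi * t) : ℝ)) ^ (j : ℕ) *
        ((∏ k, Complex.Gamma (a k + K + (x - t * Complex.I)) *
          Complex.Gamma (b k + (0 : ℕ) - (x - t * Complex.I))) *
        (Complex.exp (-n * Real.pi * Complex.I * (x - t * Complex.I)) *
        Complex.exp ((x - t * Complex.I) * (Real.pi * Complex.I)))) := by
      intro j
      have h3 : Complex.exp ((2 * (j : ℕ) - n) * Real.pi * Complex.I * (x - t * Complex.I)) =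
          (Complex.exp (2 * Real.pi * Complex.I * x) * (Real.exp (2 * Real.pi * t) : ℝ)) ^ (j : ℕ) *
          Complex.exp (-n * Real.pi * Complex.I * (x - t * Complex.I)) := by
        rw [Complex.ofReal_exp, ← Complex.exp_add, ← Complex.exp_nat_mul, ← Complex.exp_add]
        congr 1
        push_cast
        linear_combination (-2 * (j : ℕ) * Real.pi * t : ℂ) * Complex.I_sq
      simp only [barnesFun, h3, Polynomial.eval_one]
      ring
    simp only [hφ, h2, ← mul_assoc, ← Finset.sum_mul] at h1
    rw [Polynomial.IsRoot, hp, Polynomial.eval_finsetSum]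
    simp only [Polynomial.eval_mul, Polynomial.eval_C, Polynomial.eval_pow, Polynomial.eval_X]
    exact (mul_eq_zero.1 ((mul_eq_zero.1 ((mul_eq_zero.1 h1).resolve_right
      (Complex.exp_ne_zero _))).resolve_right (Complex.exp_ne_zero _))).resolve_right
      (prod_Gamma_ne_zero (hreg t))
  have hp0 : p = 0 := by
    refine Polynomial.eq_zero_of_infinite_isRoot p ((infinite_range_of_injective
      (f := fun t : ℝ => Complex.exp (2 * Real.pi * Complex.I * x) *
        (Real.exp (2 * Real.pi * t) : ℝ)) fun t t' htt => ?_).mono (range_subset_iff.2 hroot))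
    have := Real.exp_injective (Complex.ofReal_injective
      (mul_left_cancel₀ (Complex.exp_ne_zero _) htt))
    exact mul_left_cancel₀ (by positivity) this
  funext i
  have := congrArg (fun q => Polynomial.coeff q (i : ℕ)) hp0
  simpa [hp, Polynomial.finsetSum_coeff, Polynomial.coeff_X_pow, Fin.val_inj] using this

end

/-! ### The upper bound for the dimension -/

section

theorem isPreconnected_cutPlane : IsPreconnected cutPlane := by
  have h : cutPlane = Neg.neg '' Complex.slitPlane := by
    ext z
    rw [image_neg_eq_neg, Set.mem_neg]
    simp [cutPlane, Complex.slitPlane]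
  rw [h]
  exact (Complex.starConvex_one_slitPlane.isPathConnected
    Complex.one_mem_slitPlane).isConnected.isPreconnected.image _ continuous_neg.continuousOn

theorem neg_one_mem_cutPlane : (-1 : ℂ) ∈ cutPlane := Or.inl (by simp)

/-- The operator `(θ + c₁) ⋯ (θ + cₖ)` lowers the order of vanishing by at most `k`, with a leading
coefficient that does not depend on `c₁, …, cₖ`. -/
theorem foldr_thetaAdd_of_eventuallyEq_pow {f g : ℂ → ℂ} {z₀ : ℂ} (hg : AnalyticAt ℂ g z₀)
    (l : List ℂ) (m : ℕ) (hf : ∀ᶠ z in 𝓝 z₀, f z = (z - z₀) ^ (m + l.length) * g z) :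
    ∃ h : ℂ → ℂ, AnalyticAt ℂ h z₀ ∧
      h z₀ = ((m + l.length).descFactorial l.length : ℂ) * z₀ ^ l.length * g z₀ ∧
      ∀ᶠ z in 𝓝 z₀, l.foldr thetaAdd f z = (z - z₀) ^ m * h z := by
  induction l generalizing m with
  | nil => exact ⟨g, hg, by simp, by simpa using hf⟩
  | cons c l ih =>
    obtain ⟨h, hh, h0, hev⟩ := ih (m + 1) (by simpa [add_assoc, add_comm 1] using hf)
    -- One factor `z - z₀` is lost when the derivative hits the power; the terms containing `c` keep
    -- it and vanish at `z₀`.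
    refine ⟨fun z => (m + 1) * z * h z + (z - z₀) * (z * deriv h z + c * h z),
      ((analyticAt_const.mul analyticAt_id).mul hh).add ((analyticAt_id.sub analyticAt_const).mul
        ((analyticAt_id.mul hh.deriv).add (analyticAt_const.mul hh))), ?_, ?_⟩
    · simp only [h0, sub_self, zero_mul, add_zero, List.length_cons]
      have : (m + (l.length + 1)).descFactorial (l.length + 1) =
          (m + 1) * (m + 1 + l.length).descFactorial l.length := by
        rw [Nat.descFactorial_succ, show m + (l.length + 1) - l.length = m + 1 by omega,
          show m + (l.length + 1) = m + 1 + l.length by ring]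
      rw [this]
      push_cast
      ring
    · filter_upwards [hev.eventually_nhds, hh.eventually_analyticAt] with z hz hhz
      have hd : HasDerivAt (fun z => (z - z₀) ^ (m + 1) * h z) _ z :=
        (((hasDerivAt_id z).sub_const z₀).fun_pow (m + 1)).fun_mul hhz.differentiableAt.hasDerivAt
      simp only [List.foldr_cons, thetaAdd]
      rw [EventuallyEq.deriv_eq hz, hd.deriv, hz.self_of_nhds]
      simp only [id, Nat.add_sub_cancel]
      push_cast
      ring

variable {n : ℕ} {α β : Fin n → ℂ}

/-- A solution near `-1` whose derivatives of order less than `n` vanish at `-1` is zero. -/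
theorem eqOn_zero_of_hypergeometricOp_eq_zero {f : ℂ → ℂ} (hd : DifferentiableOn ℂ f cutPlane)
    (hop : ∀ z ∈ cutPlane, hypergeometricOp α β f z = 0)
    (h0 : ∀ k < n, (List.replicate k 0).foldr thetaAdd f (-1) = 0) : EqOn f 0 cutPlane := by
  have han : AnalyticOnNhd ℂ f cutPlane := hd.analyticOnNhd isOpen_cutPlane
  refine han.eqOn_zero_of_preconnected_of_eventuallyEq_zero isPreconnected_cutPlane
    neg_one_mem_cutPlane ?_
  by_contra hne
  obtain ⟨m, g, hg, hg0, hev⟩ :=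
    (han _ neg_one_mem_cutPlane).exists_eventuallyEq_pow_smul_nonzero_iff.2 hne
  simp only [smul_eq_mul] at hev
  have hdesc : ∀ m k : ℕ, ((m + k).descFactorial k : ℂ) ≠ 0 := fun m k => by
    rw [Ne, Nat.cast_eq_zero, Nat.descFactorial_eq_zero_iff_lt]
    omega
  rcases lt_or_ge m n with hm | hm
  -- For order of vanishing `m < n`, the value `θ^m f (-1)` is the nonzero leading coefficient,
  -- against the initial conditions.
  · obtain ⟨h, -, hh0, hh⟩ := foldr_thetaAdd_of_eventuallyEq_pow hg (List.replicate m 0) 0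
      (by simpa using hev)
    have := hh.self_of_nhds
    rw [h0 m hm, pow_zero, one_mul, hh0] at this
    refine mul_ne_zero (mul_ne_zero (hdesc _ _) (pow_ne_zero _ ?_)) hg0 this.symm
    norm_num
  · obtain ⟨m, rfl⟩ := Nat.exists_eq_add_of_le' hm
    obtain ⟨h₁, ha₁, h₁0, hh₁⟩ := foldr_thetaAdd_of_eventuallyEq_pow hg (List.ofFn α) m
      (by simpa using hev)
    obtain ⟨h₂, ha₂, h₂0, hh₂⟩ := foldr_thetaAdd_of_eventuallyEq_pow hg
      (List.ofFn fun k => β k - 1) m (by simpa using hev)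
    have hz : ∀ᶠ z in 𝓝[≠] (-1 : ℂ), z * h₁ z - h₂ z = 0 := by
      filter_upwards [hh₁.filter_mono nhdsWithin_le_nhds, hh₂.filter_mono nhdsWithin_le_nhds,
        (isOpen_cutPlane.mem_nhds neg_one_mem_cutPlane |> mem_nhdsWithin_of_mem_nhds),
        self_mem_nhdsWithin] with z h1 h2 h3 h4
      have h5 := hop z h3
      rw [hypergeometricOp, thetaProd, thetaProd, h1, h2] at h5
      have h6 : (z - -1) ^ m * (z * h₁ z - h₂ z) = 0 := by linear_combination h5
      exact (mul_eq_zero.1 h6).resolve_left (pow_ne_zero _ (sub_ne_zero.2 h4))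
    have hc : ContinuousAt (fun z => z * h₁ z - h₂ z) (-1 : ℂ) :=
      (continuousAt_id.mul ha₁.continuousAt).sub ha₂.continuousAt
    have hlim : (-1 : ℂ) * h₁ (-1) - h₂ (-1) = 0 :=
      tendsto_nhds_unique (hc.tendsto.mono_left nhdsWithin_le_nhds)
        (tendsto_const_nhds.congr' (hz.mono fun z hz => hz.symm))
    -- Both operator products have the same leading coefficient `L`, so the limit is `(-1 - 1) L =
    -- -2 L`, which is nonzero.
    rw [h₁0, h₂0] at hlim
    simp only [List.length_ofFn] at hlim
    refine mul_ne_zero (mul_ne_zero (mul_ne_zero (by norm_num : (-2 : ℂ) ≠ 0) (hdesc m n))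
      (pow_ne_zero n (by norm_num : (-1 : ℂ) ≠ 0))) hg0 ?_
    linear_combination hlim

/-- The extension by zero of a function on the cut plane. -/
noncomputable def extendZero (f : cutPlane → ℂ) : ℂ → ℂ := Function.extend Subtype.val f 0

theorem extendZero_apply (f : cutPlane → ℂ) (z : cutPlane) : extendZero f z = f z :=
  Subtype.val_injective.extend_apply f 0 z

theorem differentiableOn_extendZero {f : cutPlane → ℂ} (hf : f ∈ solutionSpace α β) :
    DifferentiableOn ℂ (extendZero f) cutPlane ∧
      ∀ z ∈ cutPlane, hypergeometricOp α β (extendZero f) z = 0 := by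
  obtain ⟨g, hg, hd, hop⟩ := hf
  have he : EqOn (extendZero f) g cutPlane := fun z hz => by
    rw [extendZero_apply f ⟨z, hz⟩, ← hg ⟨z, hz⟩]
  refine ⟨hd.congr he, fun z hz => ?_⟩
  rw [← hop z hz]
  simp only [hypergeometricOp, thetaProd]
  rw [foldr_thetaAdd_congr _ he hz, foldr_thetaAdd_congr _ he hz]

/-- The values at `-1` of a solution and its iterated derivatives. -/
noncomputable def initialValues (α β : Fin n → ℂ) : solutionSpace α β →ₗ[ℂ] (Fin n → ℂ) where
  toFun f k := (List.replicate k 0).foldr thetaAdd (extendZero f) (-1)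
  map_add' f g := by
    funext k
    have he : EqOn (extendZero (f + g : solutionSpace α β))
        (fun z => 1 * extendZero f z + extendZero g z) cutPlane := fun z hz => by
      simp [extendZero_apply _ ⟨z, hz⟩]
    rw [foldr_thetaAdd_congr _ he neg_one_mem_cutPlane, foldr_thetaAdd_combination _ 1
      (differentiableOn_extendZero f.2).1 (differentiableOn_extendZero g.2).1 _
      neg_one_mem_cutPlane]
    simp
  map_smul' c f := by
    funext k
    have he : EqOn (extendZero (c • f : solutionSpace α β))
        (fun z => c * extendZero f z + (fun _ => 0) z) cutPlane := fun z hz => by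
      simp [extendZero_apply _ ⟨z, hz⟩]
    rw [foldr_thetaAdd_congr _ he neg_one_mem_cutPlane, foldr_thetaAdd_combination _ c
      (differentiableOn_extendZero f.2).1 (differentiableOn_const 0) _
      neg_one_mem_cutPlane, foldr_thetaAdd_zero]
    simp

theorem initialValues_injective : Function.Injective (initialValues α β) := by
  rw [← LinearMap.ker_eq_bot, LinearMap.ker_eq_bot']
  intro f hf
  obtain ⟨hd, hop⟩ := differentiableOn_extendZero f.2
  have h0 := eqOn_zero_of_hypergeometricOp_eq_zero hd hop fun k hk => congrFun hf ⟨k, hk⟩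
  ext z
  have := h0 z.2
  rwa [extendZero_apply] at this

theorem barnesIntegral_eq (α β : Fin n → ℂ) (γ : ℝ → ℂ) (j : Fin n) (z : ℂ) :
    barnesIntegral α β γ j z = (-1) ^ n / (2 * Real.pi * Complex.I) ^ n *
      barnesInt α (fun k => 1 - β k) γ j 1 z := by
  simp [barnesIntegral, barnesInt, barnesFun, integrand]

theorem IsContour.separates {γ : ℝ → ℂ} (h : IsContour α β γ) :
    Separates γ α (fun k => 1 - β k) :=
  ⟨h.left, h.right⟩

theorem hypergeometricOp_barnesIntegral (hαβ : ∀ (k l : Fin n) (m : ℤ), α k - β l ≠ m)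
    {γ : ℝ → ℂ} (hγ : IsContour α β γ) (j : Fin n) {z : ℂ} (hz : z ∈ cutPlane) :
    hypergeometricOp α β (barnesIntegral α β γ j) z = 0 := by
  have hp := hγ.isImaginaryPath
  have hs := hγ.separates
  have hd := differentiableOn_barnesInt (j := j) (P := 1) hp hs.isRegular
  have e : barnesIntegral α β γ j = fun z => (-1) ^ n / (2 * Real.pi * Complex.I) ^ n *
      barnesInt α (fun k => 1 - β k) γ j 1 z + (fun _ => 0) z := by
    funext z
    rw [barnesIntegral_eq, add_zero]
  rw [e, hypergeometricOp_combination α β _ hd (differentiableOn_const 0) hz,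
    hypergeometricOp_zero, add_zero]
  have key := mul_barnesInt_eq_barnesInt hp hs (fun k l m e => hαβ k l (m - 1) (by
    push_cast
    linear_combination e)) j hz
  simp only [hypergeometricOp, thetaProd, foldr_thetaAdd_barnesInt hp hs.isRegular _ hz,
    List.map_ofFn, List.prod_ofFn, mul_one, Function.comp_def]
  rw [key]
  simp

theorem barnesIntegral_mem_solutionSpace (hαβ : ∀ (k l : Fin n) (m : ℤ), α k - β l ≠ m)
    {γ : ℝ → ℂ} (hγ : IsContour α β γ) (j : Fin n) :
    (fun z : cutPlane => barnesIntegral α β γ j z) ∈ solutionSpace α β := by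
  refine ⟨barnesIntegral α β γ j, fun _ => rfl, ?_,
    fun z hz => hypergeometricOp_barnesIntegral hαβ hγ j hz⟩
  simp only [funext (barnesIntegral_eq α β γ j)]
  exact (differentiableOn_barnesInt hγ.isImaginaryPath hγ.separates.isRegular).const_mul _

end

end MellinBarnes


/-! ### The basis -/

theorem mainTheorem10 {n : ℕ} (α β : Fin n → ℂ)
    (hαβ : ∀ (k l : Fin n) (m : ℤ), α k - β l ≠ m)
    (γ : ℝ → ℂ) (hγ : MellinBarnes.IsContour α β γ) :
    (∀ (j : Fin n), ∀ z ∈ MellinBarnes.cutPlane,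
      MeasureTheory.Integrable
        (fun t : ℝ => MellinBarnes.integrand α β j z (γ t) * deriv γ t)) ∧
    ∃ b : Module.Basis (Fin n) ℂ (MellinBarnes.solutionSpace α β),
      ∀ (j : Fin n) (z : MellinBarnes.cutPlane),
        (b j : MellinBarnes.cutPlane → ℂ) z = MellinBarnes.barnesIntegral α β γ j z := by
  open MellinBarnes in
  refine ⟨fun j z hz => ?_, ?_⟩
  · have := integrable_barnesFun (j := j) (P := 1) hγ.isImaginaryPath hγ.separates.isRegular
      (cutLog_im hz).1 (cutLog_im hz).2
    simpa [barnesFun, integrand] using this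
  set v : Fin n → solutionSpace α β := fun j =>
    ⟨_, barnesIntegral_mem_solutionSpace hαβ hγ j⟩ with hv
  have hli : LinearIndependent ℂ v := by
    rw [Fintype.linearIndependent_iff]
    intro c hc
    refine congrFun (eq_zero_of_sum_barnesInt_eq_zero hγ.isImaginaryPath hγ.separates
      fun z hz => ?_)
    have h1 : ∑ j, c j * barnesIntegral α β γ j z = 0 := by
      have := congrFun (congrArg Subtype.val hc) ⟨z, hz⟩
      simpa [hv] using this
    simp only [barnesIntegral_eq, mul_left_comm (c _), ← Finset.mul_sum] at h1
    refine (mul_eq_zero.1 h1).resolve_left (div_ne_zero (pow_ne_zero _ (by norm_num))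
      (pow_ne_zero _ Complex.two_pi_I_ne_zero))
  have hfin : FiniteDimensional ℂ (solutionSpace α β) :=
    Module.Finite.of_injective _ initialValues_injective
  -- Independence gives `n ≤ dim`, and the injective initial value map gives `dim ≤ n`.
  have hcard : Fintype.card (Fin n) = Module.finrank ℂ (solutionSpace α β) := by
    refine le_antisymm hli.fintype_card_le_finrank ?_
    simpa using LinearMap.finrank_le_finrank_of_injective
      (initialValues_injective (α := α) (β := β))
  refine ⟨Module.Basis.mk hli (hli.span_eq_top_of_card_eq_finrank' hcard).ge, fun j z => ?_⟩
  rw [Module.Basis.mk_apply]
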